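/- **Conventions.** Let $k$ be a field and let $K$ be a finite CW complex (Hausdorff), with set of $i$-cells $K_i$. A *weight* $w:K\to[a,b]$ assigns to every cell a number in $[a,b]$ such that $w(\sigma)\le w(\tau)$ whenever $\sigma$ is a face of $\tau$ (the open cell $\sigma$ meets the closed cell $\tau$); equivalently, each $K^w_r$, the union of the open cells $\sigma$ with $w(\sigma)\le r$, is a subcomplex. Applying degree-$i$ cellular homology over $k$ to the filtration $(K^w_r)_{r\in[a,2b-a]}$ gives a persistence module $H_i(K^w_\bullet;k)$ indexed by $[a,2b-a]$. For persistence modules $M,N$ indexed by $[a,2b-a]$ put $$d_{\mathrm{rk}}(M,N)=\int_{a\le r\le s\le 2b-a}\bigl|\operatorname{rank}M_{r\le s}-\operatorname{rank}N_{r\le s}\bigr|\,dr\,ds .$$ For $t\in[a,b]$ let $I_t$ be the interval module of $[t,2b-a]$. For finite families of intervals (barcodes) $\alpha=(I_j)_{j\in J}$ and $\beta=(I'_l)_{l\in L}$ of $[a,2b-a]$, let $W_1^{\mathrm{rk}}(\alpha,\beta)$ be the minimum, over all injections $\varphi:J'\hookrightarrow L$ with $J'\subseteq J$, of $$\sum_{j\in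 J'}d_{\mathrm{rk}}(I_j,I'_{\varphi(j)})+\sum_{j\in J\setminus J'}d_{\mathrm{rk}}(I_j,0)+\sum_{l\in L\setminus\varphi(J')}d_{\mathrm{rk}}(0,I'_l),$$ intervals being identified with their interval modules. Let $\operatorname{Dgm}_i(w)$ be the barcode of $H_i(K^w_\bullet;k)$, that is, the family of nonempty intervals in a decomposition of this module into a direct sum of interval modules (it exists, is finite, and is unique up to reindexing), and put $W_1^{\mathrm{rk}}(\operatorname{Dgm}(w),\operatorname{Dgm}(v))=\sum_{i\ge0}W_1^{\mathrm{rk}}(\operatorname{Dgm}_i(w),\operatorname{Dgm}_i(v))$. **Theorem.** Let $w,v:K\to[a,b]$ be weights on a finite CW complex $K$. Then the barcodes $\operatorname{Dgm}_i(w)$ and $\operatorname{Dgm}_i(v)$ exist for all $i$, and $$W_1^{\mathrm{rk}}(\operatorname{Dgm}(w),\operatorname{Dgm}(v))\le\sum_{\sigma\in K}d_{\mathrm{rk}}(I_{w(\sigma)},I_{v(\sigma)}),$$ and for every $i\ge 0$ $$W_1^{\mathrm{rk}}(\operatorname{Dgm}_i(w),\operatorname{Dgm}_i(v))\le\sum_{\sigma\in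 K_i\cup K_{i+1}}d_{\mathrm{rk}}(I_{w(\sigma)},I_{v(\sigma)}).$$ -/

import Mathlib

open CategoryTheory CategoryTheory.Limits Topology MeasureTheory
open scoped ENNReal ZeroObject

noncomputable section

namespace WeightedCW

/-! ### Persistence modules, interval modules and the rank metric -/

section Persistence

universe v w

/-- Persistence modules over the field `k` indexed by the poset `P`. -/
abbrev PersMod (k : Type v) [Field k] (P : Type) [Preorder P] : Type (max v (w + 1)) :=
  P ⥤ ModuleCat.{w} k

variable (k : Type v) [Field k] {P : Type} [Preorder P]

/-- The space of the interval module at `r`: it is `k` if `r ∈ I` and `0` otherwise, written as the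
space of functions to `k` from a type with one element if `r ∈ I` and no element otherwise. -/
abbrev IntervalSpace (I : Set P) (r : P) : Type (max v w) := ULift.{w} (PLift (r ∈ I)) → k

open scoped Classical in
/-- The structure map of an interval module: the identity of `k` if `r, s ∈ I`, and `0` otherwise. -/
def intervalMap (I : Set P) (r s : P) : IntervalSpace.{v, w} k I r →ₗ[k] IntervalSpace.{v, w} k I s where
  toFun f _ := if hr : r ∈ I then f ⟨⟨hr⟩⟩ else 0
  map_add' f g := by
    ext; by_cases hr : r ∈ I <;> simp [hr]
  map_smul' c f := by
    ext; by_cases hr : r ∈ I <;> simp [hr]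

/-- The interval module supported on an order-convex subset `I` of `P`. -/
def intervalModule (I : Set P) (hI : I.OrdConnected) : PersMod.{v, max v w} k P where
  obj r := ModuleCat.of k (IntervalSpace.{v, w} k I r)
  map {r s} _ := ModuleCat.ofHom (intervalMap.{v, w} k I r s)
  map_id r := by
    refine ModuleCat.hom_ext (LinearMap.ext fun f => funext fun i => ?_)
    simp [intervalMap, i.down.down]
  map_comp {r s t} f g := by
    refine ModuleCat.hom_ext (LinearMap.ext fun x => funext fun i => ?_)
    by_cases hr : r ∈ I
    · have hs : s ∈ I := hI.out hr i.down.down ⟨leOfHom f, leOfHom g⟩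
      simp [intervalMap, hr, hs]
    · simp [intervalMap, hr]

end Persistence

section Metric

universe v w

variable {k : Type v} [Field k] {a c : ℝ}

open scoped Classical in
/-- The rank invariant `(r, s) ↦ rank M_{r ≤ s}` of a persistence module indexed by `[a, c]`,
extended by zero to the plane. -/
def rankInv (M : PersMod.{v, w} k (Set.Icc a c)) (p : ℝ × ℝ) : ℕ :=
  if h : p.1 ∈ Set.Icc a c ∧ p.2 ∈ Set.Icc a c ∧ p.1 ≤ p.2 then
    Module.finrank k (LinearMap.range
      (M.map (homOfLE (show (⟨p.1, h.1⟩ : Set.Icc a c) ≤ ⟨p.2, h.2.1⟩ from h.2.2))).hom)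
  else 0

/-- The rank metric `d_rk(M, N) = ∫ |rank M - rank N|` (Lebesgue measure on the plane). -/
def dRank (M N : PersMod.{v, w} k (Set.Icc a c)) : ℝ≥0∞ :=
  ∫⁻ p : ℝ × ℝ, ENNReal.ofReal |(rankInv M p : ℝ) - (rankInv N p : ℝ)|

end Metric

/-! ### Barcodes and the 1-Wasserstein distance -/

section Barcodes

universe v w

/-- A finite barcode: a finite indexed family of nonempty intervals of `P`. -/
structure Barcode (P : Type) [Preorder P] where
  /-- number of bars -/
  card : ℕ
  /-- the bars -/
  bar : Fin card → Set P
  ordConnected : ∀ j, (bar j).OrdConnected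
  nonempty : ∀ j, (bar j).Nonempty

variable (k : Type v) [Field k]

/-- The interval module of a bar. -/
def Barcode.module {P : Type} [Preorder P] (α : Barcode P) (j : Fin α.card) :
    PersMod.{v, max v w} k P :=
  intervalModule.{v, w} k (α.bar j) (α.ordConnected j)

variable {k} in
/-- `α` is a barcode (persistence diagram) of `M`: `M` is isomorphic to the direct sum of the
interval modules of the bars of `α`. -/
def IsBarcodeOf {P : Type} [Preorder P] (α : Barcode P) (M : PersMod.{v, max v w} k P) : Prop :=
  Nonempty (M ≅ ∐ fun j : Fin α.card => α.module.{v, w} k j)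

variable {a c : ℝ}

/-- The cost of a partial matching `γ` between the bars of `α` and those of `β`, for the rank
metric: a matched pair costs the distance between its interval modules, and an unmatched bar (one
matched with the diagonal) costs the distance of its interval module from the zero module. -/
def matchingCost (α β : Barcode (Set.Icc a c)) (γ : Fin α.card ≃. Fin β.card) : ℝ≥0∞ :=
  (∑ i, match γ i with
    | some j => dRank (α.module.{v, v} k i) (β.module.{v, v} k j)
    | none => dRank (α.module.{v, v} k i) 0) +
  ∑ j, match γ.symm j with
    | some _ => 0
    | none => dRank 0 (β.module.{v, v} k j)

/-- The 1-Wasserstein distance between barcodes for the rank metric. -/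
def W1Rank (α β : Barcode (Set.Icc a c)) : ℝ≥0∞ :=
  ⨅ γ : Fin α.card ≃. Fin β.card, matchingCost k α β γ

end Barcodes

/-! ### Degrees of self-maps of spheres -/

section Degree

universe v

variable (k : Type v) [Field k]

/-- Singular homology with coefficients in `k`. -/
abbrev singH (n : ℕ) : TopCat.{0} ⥤ ModuleCat.{v} k :=
  (AlgebraicTopology.singularHomologyFunctor (ModuleCat.{v} k) n).obj (ModuleCat.of k k)

/-- Reduced singular homology: the kernel of the map to the homology of a point. -/
def redH (n : ℕ) (X : TopCat.{0}) : Submodule k ((singH k n).obj X) :=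
  LinearMap.ker ((singH k n).map
    (TopCat.ofHom (ContinuousMap.const X PUnit.unit) : X ⟶ TopCat.of PUnit.{1})).hom

lemma redH_mapsTo (n : ℕ) {X Y : TopCat.{0}} (f : X ⟶ Y) :
    ∀ x ∈ redH k n X, ((singH k n).map f).hom x ∈ redH k n Y := by
  intro x hx
  simp only [redH, LinearMap.mem_ker] at hx ⊢
  rw [← hx, ← LinearMap.comp_apply, ← ModuleCat.hom_comp, ← Functor.map_comp]
  rfl

/-- The boundary of the cube `[-1, 1]ⁿ⁺¹`, a model of the `n`-sphere. -/
abbrev Sph (n : ℕ) : Type := Metric.sphere (0 : Fin (n + 1) → ℝ) 1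

/-- The degree of a self-map of the `n`-sphere, as an element of `k`: the scalar by which it acts on
the one-dimensional space `H̃_n(Sⁿ; k)`, that is, the trace of this action. -/
def degree (n : ℕ) (f : C(Sph n, Sph n)) : k :=
  LinearMap.trace k (redH k n (TopCat.of (Sph n)))
    (((singH k n).map (TopCat.ofHom f)).hom.restrict (redH_mapsTo k n (TopCat.ofHom f)))

lemma degree_const (n : ℕ) (p : Sph n) : degree k n (ContinuousMap.const _ p) = 0 := by
  unfold degree
  convert map_zero (LinearMap.trace k (redH k n (TopCat.of (Sph n))))
  ext ⟨x, hx⟩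
  simp only [redH, LinearMap.mem_ker] at hx
  simp only [LinearMap.restrict_apply, LinearMap.zero_apply, ZeroMemClass.coe_zero]
  have : (TopCat.ofHom (ContinuousMap.const (Sph n) p) : TopCat.of (Sph n) ⟶ TopCat.of (Sph n)) =
      (TopCat.ofHom (ContinuousMap.const _ PUnit.unit) :
        TopCat.of (Sph n) ⟶ TopCat.of PUnit.{1}) ≫
      (TopCat.ofHom (ContinuousMap.const _ p) : TopCat.of PUnit.{1} ⟶ TopCat.of (Sph n)) := rfl
  rw [this, Functor.map_comp, ModuleCat.hom_comp, LinearMap.comp_apply, hx, map_zero]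

end Degree

/-! ### The cellular chain complex of a finite CW complex -/

section Cellular

open RelCWComplex

/-- The nonzero vector `(2‖y‖ - 1, (1 - ‖y‖) y)`, for `y` in the closed unit cube. -/
def preCollapse (n : ℕ) (y : Fin n → ℝ) : Fin (n + 1) → ℝ :=
  Fin.cons (2 * ‖y‖ - 1) ((1 - ‖y‖) • y)

lemma preCollapse_ne_zero (n : ℕ) (y : Fin n → ℝ) : preCollapse n y ≠ 0 := by
  intro h
  have h0 : 2 * ‖y‖ - 1 = 0 := by simpa [preCollapse] using congrFun h 0
  have h1 : (1 - ‖y‖) • y = 0 := by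
    funext i
    simpa [preCollapse] using congrFun h i.succ
  have hy : ‖y‖ = 1 / 2 := by linarith
  rcases smul_eq_zero.mp h1 with h2 | h2
  · rw [hy] at h2; norm_num at h2
  · rw [h2, norm_zero] at hy; norm_num at hy

lemma continuous_preCollapse (n : ℕ) : Continuous (preCollapse n) := by
  refine continuous_pi fun i => ?_
  refine Fin.cases ?_ (fun j => ?_) i
  · simp only [preCollapse, Fin.cons_zero]; fun_prop
  · simp only [preCollapse, Fin.cons_succ, Pi.smul_apply, smul_eq_mul]; fun_prop

/-- The standard collapse map from the `n`-cube onto the `n`-sphere. It sends the boundary of the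
cube to the pole and is injective on the interior, so it induces a homeomorphism from the quotient
of the cube by its boundary to the sphere. -/
def collapse (n : ℕ) (y : Fin n → ℝ) : Sph n :=
  ⟨‖preCollapse n y‖⁻¹ • preCollapse n y, by
    rw [mem_sphere_zero_iff_norm, norm_smul, norm_inv, norm_norm,
      inv_mul_cancel₀ (norm_ne_zero_iff.mpr (preCollapse_ne_zero n y))]⟩

lemma continuous_collapse (n : ℕ) : Continuous (collapse n) := by
  refine Continuous.subtype_mk ?_ _
  exact ((continuous_preCollapse n).norm.inv₀
    fun y => norm_ne_zero_iff.mpr (preCollapse_ne_zero n y)).smul (continuous_preCollapse n)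

/-- The pole of the sphere: the common value of the collapse map on the boundary of the cube. -/
def pole (n : ℕ) : Sph n :=
  ⟨Pi.single 0 1, by simp [Pi.norm_single]⟩

lemma collapse_eq_pole {n : ℕ} {y : Fin n → ℝ} (hy : ‖y‖ = 1) : collapse n y = pole n := by
  have : preCollapse n y = Pi.single 0 1 := by
    funext i
    refine Fin.cases ?_ (fun j => ?_) i
    · simp only [preCollapse, Fin.cons_zero, hy, Pi.single_eq_same]; norm_num
    · simp [preCollapse, hy]
  refine Subtype.ext ?_
  simp [collapse, pole, this, Pi.norm_single]

universe u v

variable {X : Type u} [TopologicalSpace X] [T2Space X] (K : Set X) [CWComplex K]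

variable {K} in
open scoped Classical in
/-- The map that collapses the complement of the open `n`-cell `σ` to the pole of the `n`-sphere and
that is the collapse map of the cube on `σ`, read through the characteristic map of `σ`. -/
def collapseTo {n : ℕ} (σ : cell K n) (x : X) : Sph n :=
  if x ∈ openCell n σ then collapse n ((map n σ).symm x) else pole n

variable {K} in
lemma collapseTo_map {n : ℕ} (σ : cell K n) {y : Fin n → ℝ} (hy : y ∈ Metric.closedBall 0 1) :
    collapseTo σ (map n σ y) = collapse n y := by
  rw [mem_closedBall_zero_iff] at hy
  rcases hy.lt_or_eq with h | h
  · have hb : y ∈ Metric.ball (0 : Fin n → ℝ) 1 := by simpa using h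
    rw [collapseTo, if_pos ⟨y, hb, rfl⟩, (map n σ).left_inv (by rwa [source_eq])]
  · rw [collapse_eq_pole h, collapseTo, if_neg]
    intro hx
    have hfr : map n σ y ∈ cellFrontier n σ := ⟨y, by simpa using h, rfl⟩
    have h1 := cellFrontier_subset_skeletonLT (C := K) n σ hfr
    exact (disjoint_skeletonLT_openCell (C := K) (le_refl (n : ℕ∞))).notMem_of_mem_left h1 hx

variable {K} in
lemma continuousOn_collapseTo {n : ℕ} (σ : cell K n) :
    ContinuousOn (collapseTo σ) (skeleton K n : Set X) := by
  have hclosed : ContinuousOn (collapseTo σ) (closedCell n σ) := by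
    rw [continuousOn_iff_isClosed]
    intro Z hZ
    refine ⟨map n σ '' (Metric.closedBall 0 1 ∩ collapse n ⁻¹' Z), ?_, ?_⟩
    · refine IsCompact.isClosed (IsCompact.image_of_continuousOn ?_
        ((RelCWComplex.continuousOn n σ).mono Set.inter_subset_left))
      exact (isCompact_closedBall _ _).inter_right (hZ.preimage (continuous_collapse n))
    · ext x
      constructor
      · rintro ⟨hx, y, hy, rfl⟩
        refine ⟨⟨y, ⟨hy, ?_⟩, rfl⟩, y, hy, rfl⟩
        rwa [Set.mem_preimage, collapseTo_map σ hy] at hx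
      · rintro ⟨⟨y, ⟨hy, hz⟩, rfl⟩, hx⟩
        refine ⟨?_, hx⟩
        rwa [Set.mem_preimage, collapseTo_map σ hy]
  have hout : ContinuousOn (collapseTo σ) ((skeleton K n : Set X) \ openCell n σ) := by
    refine (continuousOn_const (c := pole n)).congr fun x hx => ?_
    rw [collapseTo, if_neg hx.2]
  have hcl : IsClosed ((skeleton K n : Set X) \ openCell n σ) := by
    refine CWComplex.isClosed_of_disjoint_openCell_or_isClosed_inter_closedCell
      (Set.sdiff_subset.trans (RelCWComplex.Subcomplex.subset_complex (C := K) _)) ?_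
    intro m _ j
    by_cases hj : (⟨n, σ⟩ : Σ n, cell K n) = ⟨m, j⟩
    · left
      obtain rfl : n = m := congrArg Sigma.fst hj
      obtain rfl : σ = j := eq_of_heq (Sigma.mk.inj hj).2
      exact Set.disjoint_sdiff_left
    rcases lt_or_ge n m with hm | hm
    · left
      refine Disjoint.mono_left Set.sdiff_subset ?_
      exact disjoint_skeleton_openCell (C := K) (by exact_mod_cast hm)
    · right
      have : ((skeleton K n : Set X) \ openCell n σ) ∩ closedCell m j = closedCell m j := by
        refine Set.inter_eq_right.mpr fun x hx => ⟨?_, fun hxσ => ?_⟩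
        · exact skeleton_mono (C := K) (by exact_mod_cast hm)
            (closedCell_subset_skeleton (C := K) m j hx)
        · rw [← cellFrontier_union_openCell_eq_closedCell] at hx
          rcases hx with hx | hx
          · have h1 := cellFrontier_subset_skeletonLT (C := K) m j hx
            have h2 := skeletonLT_mono (C := K) (show (m : ℕ∞) ≤ n by exact_mod_cast hm) h1
            exact (disjoint_skeletonLT_openCell (C := K)
              (le_refl (n : ℕ∞))).notMem_of_mem_left h2 hxσ
          · exact (disjoint_openCell_of_ne hj).notMem_of_mem_left hxσ hx
      rw [this]
      exact isClosed_closedCell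
  have hun : (skeleton K n : Set X) ⊆ ((skeleton K n : Set X) \ openCell n σ) ∪ closedCell n σ := by
    intro x hx
    by_cases h : x ∈ openCell n σ
    · exact Or.inr (openCell_subset_closedCell n σ h)
    · exact Or.inl ⟨hx, h⟩
  exact (hout.union_of_isClosed hclosed hcl isClosed_closedCell).mono hun

variable {K} in
/-- For an `(n+1)`-cell `τ` and an `n`-cell `σ`, the self-map of the `n`-sphere obtained by composing
the attaching map of `τ` with the collapse of the `n`-skeleton onto the sphere of `σ`. -/
def attachCollapse {n : ℕ} (τ : cell K (n + 1)) (σ : cell K n) : C(Sph n, Sph n) where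
  toFun x := collapseTo σ (map (n + 1) τ x)
  continuous_toFun := by
    have h1 : ContinuousOn (map (n + 1) τ) (Metric.sphere 0 1) :=
      (RelCWComplex.continuousOn (n + 1) τ).mono Metric.sphere_subset_closedBall
    have h2 : Set.MapsTo (map (n + 1) τ) (Metric.sphere 0 1) (skeleton K n : Set X) := fun x hx =>
      cellFrontier_subset_skeleton (C := K) n τ ⟨x, hx, rfl⟩
    exact continuousOn_iff_continuous_domRestrict.mp ((continuousOn_collapseTo σ).comp h1 h2)

variable (k : Type v) [Field k]

variable {K} in
/-- The incidence number of `τ` and `σ` in `k`: the degree of the above map. -/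
def incidence {n : ℕ} (τ : cell K (n + 1)) (σ : cell K n) : k :=
  degree k n (attachCollapse τ σ)

variable {K} in
lemma incidence_eq_zero {n : ℕ} (τ : cell K (n + 1)) (σ : cell K n)
    (h : Disjoint (openCell n σ) (closedCell (n + 1) τ)) : incidence k τ σ = 0 := by
  have : attachCollapse τ σ = ContinuousMap.const _ (pole n) := by
    ext1 x
    refine if_neg fun hx => h.notMem_of_mem_left hx ?_
    exact ⟨x, Metric.sphere_subset_closedBall x.2, rfl⟩
  rw [incidence, this, degree_const]

variable {K} in
/-- The cellular chains `C_n(E; k)` of a subcomplex `E`: the span of the `n`-cells of `E`, that is,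
the chains whose coefficients vanish at the cells outside `E`. -/
def chains (E : Subcomplex K) (n : ℕ) : Submodule k (cell K n → k) where
  carrier := {x | ∀ σ, σ ∉ E.I n → x σ = 0}
  add_mem' hx hy σ hσ := by simp [hx σ hσ, hy σ hσ]
  zero_mem' _ _ := rfl
  smul_mem' c x hx σ hσ := by simp [hx σ hσ]

variable {K} in
lemma chains_mono {E F : Subcomplex K} (h : E ≤ F) (n : ℕ) : chains k E n ≤ chains k F n := by
  intro x hx σ hσF
  refine hx σ fun hσ => ?_
  have h1 := RelCWComplex.map_zero_mem_openCell (C := K) n σ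
  have h2 := RelCWComplex.Subcomplex.openCell_subset_of_mem E hσ h1
  exact (RelCWComplex.Subcomplex.disjoint_openCell_subcomplex_of_not_mem F hσF).notMem_of_mem_left
    h1 (h h2)

variable [CWComplex.Finite K]

instance finite_cell (n : ℕ) : Finite (cell K n) :=
  RelCWComplex.FiniteType.finite_cell (C := K) n

/-- The cells of each dimension of a finite CW complex form a finite type. -/
instance fintypeCell (n : ℕ) : Fintype (cell K n) :=
  Fintype.ofFinite _

/-- The cellular boundary map `C_{n+1}(K; k) → C_n(K; k)`, `τ ↦ ∑_σ [τ : σ] σ`. As there are finitely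
many cells, a chain is given as the family of its coefficients. -/
def boundary (n : ℕ) : (cell K (n + 1) → k) →ₗ[k] (cell K n → k) :=
  Matrix.mulVecLin (Matrix.of fun σ τ => incidence k τ σ)

variable {K}

/-- The boundary maps restrict to the chains of a subcomplex. -/
lemma boundary_mem_chains (E : Subcomplex K) (n : ℕ) {x : cell K (n + 1) → k}
    (hx : x ∈ chains k E (n + 1)) : boundary K k n x ∈ chains k E n := by
  intro σ hσ
  simp only [boundary, Matrix.mulVecLin_apply, Matrix.mulVec, dotProduct, Matrix.of_apply]
  refine Finset.sum_eq_zero fun τ _ => ?_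
  by_cases hτ : τ ∈ E.I (n + 1)
  · rw [incidence_eq_zero k τ σ, zero_mul]
    exact (RelCWComplex.Subcomplex.disjoint_openCell_subcomplex_of_not_mem E hσ).mono_right
      (RelCWComplex.Subcomplex.closedCell_subset_of_mem E hτ)
  · rw [hx τ hτ, mul_zero]

/-- The cycles `Z_n(E; k)`. -/
def cycles (E : Subcomplex K) : (n : ℕ) → Submodule k (cell K n → k)
  | 0 => chains k E 0
  | n + 1 => chains k E (n + 1) ⊓ LinearMap.ker (boundary K k n)

/-- The boundaries `B_n(E; k)`. -/
def boundaries (E : Subcomplex K) (n : ℕ) : Submodule k (cell K n → k) :=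
  (chains k E (n + 1)).map (boundary K k n)

lemma cycles_mono {E F : Subcomplex K} (h : E ≤ F) (n : ℕ) : cycles k E n ≤ cycles k F n := by
  cases n with
  | zero => exact chains_mono k h 0
  | succ n => exact inf_le_inf_right _ (chains_mono k h (n + 1))

lemma boundaries_mono {E F : Subcomplex K} (h : E ≤ F) (n : ℕ) :
    boundaries k E n ≤ boundaries k F n :=
  Submodule.map_mono (chains_mono k h (n + 1))

/-- The cellular homology `H_n(E; k) = Z_n(E; k) / B_n(E; k)` of a subcomplex, written as the quotient
of the space of cycles by the boundaries in it. -/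
abbrev Homology (E : Subcomplex K) (n : ℕ) : Type (max u v) :=
  cycles k E n ⧸ (boundaries k E n).comap (cycles k E n).subtype

/-- The map in cellular homology induced by an inclusion of subcomplexes. -/
def homologyMap {E F : Subcomplex K} (h : E ≤ F) (n : ℕ) : Homology k E n →ₗ[k] Homology k F n :=
  Submodule.mapQ _ _ (Submodule.inclusion (cycles_mono k h n))
    fun _ hx => boundaries_mono k h n hx

variable (K) in
/-- Cellular homology as a functor on the subcomplexes of `K` and their inclusions. -/
def homologyFunctor (n : ℕ) : Subcomplex K ⥤ ModuleCat.{max u v} k where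
  obj E := ModuleCat.of k (Homology k E n)
  map f := ModuleCat.ofHom (homologyMap k (leOfHom f) n)
  map_id E := by
    refine ModuleCat.hom_ext (Submodule.linearMap_qext _ (LinearMap.ext fun x => ?_))
    rfl
  map_comp f g := by
    refine ModuleCat.hom_ext (Submodule.linearMap_qext _ (LinearMap.ext fun x => ?_))
    rfl

end Cellular

/-! ### Weights and sublevel filtrations -/

section Weights

open RelCWComplex

universe u v

variable {X : Type u} [TopologicalSpace X] [T2Space X] (K : Set X) [CWComplex K]

/-- A weight `K → [a, b]`: a function on the cells that is monotone for the face relation, in which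
`σ` is a face of `τ` if the open cell `σ` meets the closed cell `τ`. -/
structure Weight (a b : ℝ) where
  /-- the weight of a cell -/
  val : (n : ℕ) → cell K n → ℝ
  mem_Icc : ∀ n σ, val n σ ∈ Set.Icc a b
  mono : ∀ (m n : ℕ) (σ : cell K m) (τ : cell K n),
    (openCell m σ ∩ closedCell n τ).Nonempty → val m σ ≤ val n τ

variable {K} {a b : ℝ}

/-- The sublevel subcomplex `K^w_r`, whose cells are those of weight at most `r`. -/
def Weight.sublevel (w : Weight K a b) (r : ℝ) : Subcomplex K :=
  CWComplex.Subcomplex.mk' K (⋃ (n : ℕ) (σ : {σ : cell K n | w.val n σ ≤ r}), openCell (C := K) n σ)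
    (fun n => {σ | w.val n σ ≤ r})
    (by
      rintro n ⟨τ, hτ⟩ x hx
      have hxK := closedCell_subset_complex n τ hx
      rw [← CWComplex.iUnion_openCell_eq_complex (C := K)] at hxK
      obtain ⟨m, σ, hσ⟩ := by simpa only [Set.mem_iUnion] using hxK
      simp only [Set.mem_iUnion]
      exact ⟨m, ⟨σ, (w.mono m n σ τ ⟨x, hσ, hx⟩).trans hτ⟩, hσ⟩)
    rfl

lemma Weight.sublevel_mono (w : Weight K a b) : Monotone w.sublevel := by
  intro r s hrs x hx
  change x ∈ (⋃ (n : ℕ) (σ : {σ : cell K n | w.val n σ ≤ r}), openCell (C := K) n σ) at hx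
  change x ∈ (⋃ (n : ℕ) (σ : {σ : cell K n | w.val n σ ≤ s}), openCell (C := K) n σ)
  simp only [Set.mem_iUnion] at hx ⊢
  obtain ⟨n, ⟨σ, hσ⟩, hx⟩ := hx
  exact ⟨n, ⟨σ, le_trans hσ hrs⟩, hx⟩

/-- The sublevel filtration `K^w_•` indexed by `[a, 2b - a]`. -/
def Weight.filtration (w : Weight K a b) : Set.Icc a (2 * b - a) ⥤ Subcomplex K :=
  Monotone.functor (f := fun r : Set.Icc a (2 * b - a) => w.sublevel r)
    fun _ _ h => w.sublevel_mono h

/-- The persistent homology `H_i(K^w_•; k)`, a persistence module indexed by `[a, 2b - a]`. -/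
def Weight.persHomology [CWComplex.Finite K] (k : Type v) [Field k] (w : Weight K a b) (i : ℕ) :
    PersMod.{v, max v u} k (Set.Icc a (2 * b - a)) :=
  w.filtration ⋙ homologyFunctor K k i

/-- The interval module of `[t, 2b - a]`, indexed by `[a, 2b - a]`; at `t = w(σ)` it is the free
module `I_{w(σ)}` generated by the cell `σ`. -/
def freeModule (k : Type v) [Field k] (a b t : ℝ) : PersMod.{v, v} k (Set.Icc a (2 * b - a)) :=
  intervalModule.{v, v} k {r | t ≤ (r : ℝ)} ⟨fun _ hx _ _ _ hz => le_trans (α := ℝ) hx hz.1⟩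

end Weights

end WeightedCW

end

noncomputable section

namespace WeightedCW

/-! ### Leading terms and adapted bases -/

section LeadingTerms

variable {k I I' : Type*} [Field k]

/-- The functions that vanish outside `S`. -/
def supportedOn (k : Type*) [Field k] {I : Type*} (S : Set I) : Submodule k (I → k) where
  carrier := {x | ∀ p, p ∉ S → x p = 0}
  add_mem' hx hy p hp := by simp [hx p hp, hy p hp]
  zero_mem' _ _ := rfl
  smul_mem' c x hx p hp := by simp [hx p hp]

lemma supportedOn_mono {S T : Set I} (h : S ⊆ T) : supportedOn k S ≤ supportedOn k T :=
  fun _ hx p hp => hx p fun hS => hp (h hS)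

variable [LinearOrder I] [LinearOrder I']

/-- `p` is the position of the leading (that is, last nonzero) coefficient of `x`. -/
def IsLead (x : I → k) (p : I) : Prop := x p ≠ 0 ∧ ∀ q, p < q → x q = 0

/-- The positions of the leading coefficients of the elements of `U`. -/
def leads (U : Submodule k (I → k)) : Set I := {p | ∃ x ∈ U, IsLead x p}

lemma leads_mono {U V : Submodule k (I → k)} (h : U ≤ V) : leads U ⊆ leads V :=
  fun _ ⟨x, hx, hp⟩ => ⟨x, h hx, hp⟩

lemma exists_isLead [Finite I] {x : I → k} (hx : x ≠ 0) : ∃ p, IsLead x p := by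
  obtain ⟨q, hq⟩ := Function.ne_iff.mp hx
  obtain ⟨p, hp, hmax⟩ := Set.exists_max_image {p | x p ≠ 0} id (Set.toFinite _) ⟨q, hq⟩
  exact ⟨p, hp, fun r hr => by_contra fun h => (hmax r h).not_gt hr⟩

lemma IsLead.mem_supportedOn {x : I → k} {p : I} (h : IsLead x p) {S : Set I} (hS : IsLowerSet S)
    (hp : p ∈ S) : x ∈ supportedOn k S :=
  fun q hq => h.2 q (lt_of_not_ge fun hqp => hq (hS hqp hp))

/-- Triangularity: from position `p` on, vectors of smaller index have already stopped and those of
larger index have coefficient zero, so only the term of index `p` matters. -/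
lemma IsLead.sum_smul [Fintype I] {z : I → I → k} (hz : ∀ p, IsLead (z p) p) {c : I → k} {p : I}
    (hc : IsLead c p) : IsLead (∑ q, c q • z q) p := by
  have key : ∀ r, p ≤ r → ∀ q, q ≠ p → c q * z q r = 0 := by
    intro r hr q hq
    rcases hq.lt_or_gt with h | h
    · rw [(hz q).2 r (h.trans_le hr), mul_zero]
    · rw [hc.2 q h, zero_mul]
  constructor
  · simp only [Finset.sum_apply, Pi.smul_apply, smul_eq_mul]
    rw [Finset.sum_eq_single p (fun q _ hq => key p le_rfl q hq) (by simp)]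
    exact mul_ne_zero hc.1 (hz p).1
  · intro r hr
    rw [Finset.sum_apply]
    refine Finset.sum_eq_zero fun q _ => ?_
    by_cases hq : q = p
    · subst hq
      simp [(hz q).2 r hr]
    · exact key r hr.le q hq

lemma linearIndependent_of_isLead [Fintype I] {z : I → I → k} (hz : ∀ p, IsLead (z p) p) :
    LinearIndependent k z := by
  rw [Fintype.linearIndependent_iff]
  intro c hc
  by_contra! h
  obtain ⟨p, hp⟩ := exists_isLead (x := c) (fun h0 => by simp [h0] at h)
  exact (IsLead.sum_smul hz hp).1 (by rw [hc]; rfl)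

/-- A basis with distinct leading positions that contains enough elements of `U` describes `U` as a
coordinate subspace. -/
lemma mem_iff_repr_support [Fintype I] (b : Module.Basis I k (I → k)) (hb : ∀ p, IsLead (b p) p)
    (U : Submodule k (I → k)) (hU : ∀ p ∈ leads U, b p ∈ U) (x : I → k) :
    x ∈ U ↔ ∀ p, b.repr x p ≠ 0 → p ∈ leads U := by
  classical
  constructor
  · intro hx
    by_contra! h
    set c : I → k := fun p => if p ∈ leads U then 0 else b.repr x p with hc
    have hmem : ∑ p, c p • b p ∈ U := by
      -- The part of `x` with coordinates outside `leads U` is `x` minus basis vectors in `U`, hence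
      -- lies in `U`. If it were nonzero, its leading position would lie both in and outside `leads
      -- U`.
      have : ∑ p, c p • b p = x - ∑ p, (b.repr x p - c p) • b p := by
        simp only [sub_smul, Finset.sum_sub_distrib, b.sum_repr]; abel
      rw [this]
      refine U.sub_mem hx (U.sum_mem fun p _ => ?_)
      by_cases hp : p ∈ leads U
      · exact U.smul_mem _ (hU p hp)
      · simp [hc, hp]
    obtain ⟨p, hp, hpU⟩ := h
    obtain ⟨q, hq⟩ := exists_isLead (x := c) fun h0 => hp (by simpa [hc, hpU] using congrFun h0 p)
    have : q ∈ leads U := ⟨_, hmem, IsLead.sum_smul hb hq⟩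
    exact hq.1 (by simp [hc, this])
  · intro h
    rw [← b.sum_repr x]
    refine U.sum_mem fun p _ => ?_
    by_cases hp : b.repr x p = 0
    · simp [hp]
    · exact U.smul_mem _ (hU p (h p hp))

/-- The elements of `Z` that are images of elements supported on `T`. -/
def imageIn (D : (I' → k) →ₗ[k] (I → k)) (Z : Submodule k (I → k)) (T : Set I') :
    Submodule k (I → k) :=
  (supportedOn k T).map D ⊓ Z

omit [LinearOrder I] [LinearOrder I'] in
lemma imageIn_mono (D : (I' → k) →ₗ[k] (I → k)) (Z : Submodule k (I → k)) {S T : Set I'}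
    (h : S ⊆ T) : imageIn D Z S ≤ imageIn D Z T :=
  inf_le_inf_right _ (Submodule.map_mono (supportedOn_mono h))

/-- Take `t` to be the leading position of a preimage, which is nonzero because its image is. -/
lemma exists_mem_leads_imageIn_Iic [Finite I'] {D : (I' → k) →ₗ[k] (I → k)}
    {Z : Submodule k (I → k)} {T : Set I'} {p : I} (hp : p ∈ leads (imageIn D Z T)) :
    ∃ t ∈ T, p ∈ leads (imageIn D Z (Set.Iic t)) := by
  obtain ⟨_, ⟨⟨y, hy, rfl⟩, hZ⟩, hlead⟩ := hp
  obtain ⟨t, ht⟩ := exists_isLead (x := y) fun h0 => hlead.1 (by simp [h0])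
  exact ⟨t, by_contra fun h => ht.1 (hy t h), _,
    ⟨⟨y, ht.mem_supportedOn (isLowerSet_Iic t) Set.self_mem_Iic, rfl⟩, hZ⟩, hlead⟩

/-- One step of Gaussian elimination, with the entry of `x` at `t` as pivot. -/
lemma sub_smul_mem_supportedOn_Iio {x y : I' → k} {t : I'} (hx : x ∈ supportedOn k (Set.Iic t))
    (hy : y ∈ supportedOn k (Set.Iic t)) (hxt : x t ≠ 0) :
    y - (y t / x t) • x ∈ supportedOn k (Set.Iio t) := by
  intro s hs
  rcases (not_lt.mp hs).eq_or_lt with h | h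
  · subst h
    simp [hxt]
  · simp [hx s (not_le.mpr h), hy s (not_le.mpr h)]

/-- A common adapted basis of the filtrations of `Z` by supports and by images of supports, with the
pairing of leading positions it induces. -/
theorem exists_adapted_basis [Fintype I] [Finite I'] (D : (I' → k) →ₗ[k] (I → k))
    (Z : Submodule k (I → k)) :
    ∃ (b : Module.Basis I k (I → k)) (τ : I → Option I'),
      (∀ S : Set I, IsLowerSet S → ∀ x, x ∈ supportedOn k S ⊓ Z ↔
        ∀ p, b.repr x p ≠ 0 → p ∈ S ∧ p ∈ leads Z) ∧
      (∀ T : Set I', IsLowerSet T → ∀ x, x ∈ imageIn D Z T ↔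
        ∀ p, b.repr x p ≠ 0 → ∃ t ∈ T, τ p = some t) ∧
      (∀ p q t, τ p = some t → τ q = some t → p = q) ∧
      (∀ p t, τ p = some t → p ∈ leads Z ∧ t ∉ leads (LinearMap.ker D)) := by
  classical
  -- `τ p` is the first `t` such that some chain supported up to `t` has its image in `Z` with
  -- leading position `p`; it is `none` if there is no such `t`.
  have hτ : ∀ p, ∃ o : Option I', (∀ t, o = some t → p ∈ leads (imageIn D Z (Set.Iic t)) ∧
      ∀ s, p ∈ leads (imageIn D Z (Set.Iic s)) → t ≤ s) ∧
      ∀ s, p ∈ leads (imageIn D Z (Set.Iic s)) → o ≠ none := by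
    intro p
    by_cases h : {t | p ∈ leads (imageIn D Z (Set.Iic t))}.Nonempty
    · obtain ⟨t, ht, hmin⟩ := Set.exists_min_image _ id (Set.toFinite _) h
      refine ⟨some t, ?_, by simp⟩
      rintro _ ⟨⟩
      exact ⟨ht, hmin⟩
    · exact ⟨none, by simp, fun s hs => (h ⟨s, hs⟩).elim⟩
  choose τ hτ hτ' using hτ
  have hz : ∀ p, ∃ z : I → k, IsLead z p ∧ (p ∈ leads Z → z ∈ Z) ∧
      ∀ t, τ p = some t → z ∈ imageIn D Z (Set.Iic t) := by
    intro p
    by_cases hp : p ∈ leads Z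
    · rcases ho : τ p with _ | t
      · obtain ⟨z, hz, hl⟩ := hp
        exact ⟨z, hl, fun _ => hz, by simp⟩
      · obtain ⟨z, hz, hl⟩ := (hτ p t ho).1
        refine ⟨z, hl, fun _ => hz.2, ?_⟩
        rintro _ ⟨⟩
        exact hz
    -- Outside `leads Z` any vector with leading position `p` will do: `τ p` is `none` there, since
    -- `imageIn` lies in `Z`.
    · refine ⟨Pi.single p 1, ⟨by simp, fun q hq => by simp [hq.ne']⟩, fun h => (hp h).elim,
        fun t ht => (hp ?_).elim⟩
      exact leads_mono inf_le_right (hτ p t ht).1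
  choose z hlead hzZ hzW using hz
  set b : Module.Basis I k (I → k) :=
    basisOfPiSpaceOfLinearIndependent (linearIndependent_of_isLead hlead) with hb
  have hbz : ∀ p, b p = z p := fun p => by simp [hb]
  have hblead : ∀ p, IsLead (b p) p := fun p => hbz p ▸ hlead p
  have hnot : ∀ p t, τ p = some t → ∀ x ∈ supportedOn k (Set.Iio t), D x ∈ Z → ¬ IsLead (D x) p := by
    intro p t ht x hx hxZ hl
    obtain ⟨s, hs, hps⟩ := exists_mem_leads_imageIn_Iic (T := Set.Iio t)
      (show p ∈ leads (imageIn D Z (Set.Iio t)) from ⟨_, ⟨⟨x, hx, rfl⟩, hxZ⟩, hl⟩)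
    exact ((hτ p t ht).2 s hps).not_gt hs
  have hne : ∀ p t, τ p = some t → ∀ x ∈ supportedOn k (Set.Iic t), D x = z p → x t ≠ 0 := by
    intro p t ht x hx hxz h0
    refine hnot p t ht x (fun s hs => ?_) (hxz ▸ (hzW p t ht).2) (hxz ▸ hlead p)
    rcases (not_lt.mp hs).eq_or_lt with h | h
    · exact h ▸ h0
    · exact hx s (not_le.mpr h)
  have hmono : ∀ p t, τ p = some t → p ∈ leads Z := fun p t ht =>
    leads_mono inf_le_right (hτ p t ht).1
  refine ⟨b, τ, ?_, ?_, ?_, ?_⟩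
  · intro S hS x
    have hl : ∀ p, p ∈ leads (supportedOn k S ⊓ Z) ↔ p ∈ S ∧ p ∈ leads Z := by
      intro p
      constructor
      · rintro ⟨y, hy, hp⟩
        exact ⟨by_contra fun h => hp.1 (hy.1 p h), y, hy.2, hp⟩
      · rintro ⟨hpS, y, hy, hp⟩
        exact ⟨y, ⟨hp.mem_supportedOn hS hpS, hy⟩, hp⟩
    rw [mem_iff_repr_support b hblead _ _ x]
    · simp only [hl]
    · intro p hp
      rw [hl] at hp
      exact ⟨(hblead p).mem_supportedOn hS hp.1, hbz p ▸ hzZ p hp.2⟩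
  · intro T hT x
    have hl : ∀ p, p ∈ leads (imageIn D Z T) ↔ ∃ t ∈ T, τ p = some t := by
      intro p
      constructor
      · intro hp
        obtain ⟨s, hs, hps⟩ := exists_mem_leads_imageIn_Iic hp
        obtain ⟨t, ht⟩ := Option.ne_none_iff_exists'.mp (hτ' p s hps)
        exact ⟨t, hT ((hτ p t ht).2 s hps) hs, ht⟩
      · rintro ⟨t, ht, hpt⟩
        exact leads_mono (imageIn_mono D Z (hT.Iic_subset ht)) (hτ p t hpt).1
    rw [mem_iff_repr_support b hblead _ _ x]
    · simp only [hl]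
    · intro p hp
      obtain ⟨t, ht, hpt⟩ := (hl p).mp hp
      exact hbz p ▸ imageIn_mono D Z (hT.Iic_subset ht) (hzW p t hpt)
  -- If `p < q` were paired with the same `t`, eliminating the entry at `t` between the two
  -- preimages would give a chain strictly before `t` whose image still leads at `q`, against the
  -- minimality of `τ q`.
  · have hlt : ∀ p q t, τ p = some t → τ q = some t → ¬ p < q := by
      intro p q t hp hq hpq
      obtain ⟨⟨x, hx, hxp⟩, hpZ⟩ := hzW p t hp
      obtain ⟨⟨y, hy, hyq⟩, hqZ⟩ := hzW q t hq
      have hD : D (y - (y t / x t) • x) = z q - (y t / x t) • z p := by simp [hxp, hyq]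
      refine hnot q t hq _ (sub_smul_mem_supportedOn_Iio hx hy (hne p t hp x hx hxp)) ?_ ?_
      · rw [hD]
        exact Z.sub_mem hqZ (Z.smul_mem _ hpZ)
      · rw [hD]
        refine ⟨by simpa [(hlead p).2 q hpq] using (hlead q).1, fun r hr => ?_⟩
        simp [(hlead p).2 r (hpq.trans hr), (hlead q).2 r hr]
    intro p q t hp hq
    exact le_antisymm (not_lt.mp (hlt q p t hq hp)) (not_lt.mp (hlt p q t hp hq))
  · refine fun p t ht => ⟨hmono p t ht, ?_⟩
    -- An element of the kernel leading at `t` could be subtracted from the preimage of `z p`: the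
    -- image would not change, but the support would move strictly before `t`.
    rintro ⟨y, hy, hyt⟩
    obtain ⟨⟨x, hx, hxp⟩, hpZ⟩ := hzW p t ht
    have hD : D (x - (x t / y t) • y) = z p := by simp [hxp, LinearMap.mem_ker.mp hy]
    exact hnot p t ht _ (sub_smul_mem_supportedOn_Iio
      (hyt.mem_supportedOn (isLowerSet_Iic t) Set.self_mem_Iic) hx hyt.1)
      (hD ▸ hpZ) (hD ▸ hlead p)

end LeadingTerms

/-! ### Direct sums of interval modules and their ranks -/

section IntervalSums

universe v w

variable (k : Type v) [Field k] {P : Type} [Preorder P]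

/-- The structure map of the pointwise product of interval modules. -/
def sumMap {ι : Type} (F : ι → Set P) (r s : P) :
    (∀ j, IntervalSpace.{v, w} k (F j) r) →ₗ[k] ∀ j, IntervalSpace.{v, w} k (F j) s :=
  LinearMap.pi fun j => (intervalMap.{v, w} k (F j) r s).comp (LinearMap.proj j)

omit [Preorder P] in
lemma sumMap_single {ι : Type} [DecidableEq ι] (F : ι → Set P) (r s : P) (j : ι)
    (f : IntervalSpace.{v, w} k (F j) r) :
    sumMap.{v, w} k F r s (Pi.single j f) = Pi.single j (intervalMap.{v, w} k (F j) r s f) := by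
  funext i
  by_cases h : i = j
  · subst h
    simp [sumMap]
  · simp [sumMap, h]

/-- The pointwise product of the interval modules of the bars of `α`. -/
def Barcode.sumModule (α : Barcode P) : PersMod.{v, max v w} k P where
  obj r := ModuleCat.of k (∀ j, IntervalSpace.{v, w} k (α.bar j) r)
  map {r s} _ := ModuleCat.ofHom (sumMap.{v, w} k α.bar r s)
  map_id r := by
    refine ModuleCat.hom_ext (LinearMap.ext fun f => funext fun j => ?_)
    exact LinearMap.congr_fun (ModuleCat.hom_ext_iff.mp ((α.module.{v, w} k j).map_id r)) (f j)
  map_comp {r s t} g h := by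
    refine ModuleCat.hom_ext (LinearMap.ext fun f => funext fun j => ?_)
    exact LinearMap.congr_fun (ModuleCat.hom_ext_iff.mp ((α.module.{v, w} k j).map_comp g h)) (f j)

/-- The projections and inclusions of the pointwise product of interval modules. -/
def Barcode.sumBicone (α : Barcode P) : Bicone fun j : Fin α.card => α.module.{v, w} k j where
  pt := α.sumModule.{v, w} k
  π j := { app := fun r => ModuleCat.ofHom (LinearMap.proj j) }
  ι j :=
    { app := fun r => ModuleCat.ofHom
        (LinearMap.single k (fun j => IntervalSpace.{v, w} k (α.bar j) r) j)
      naturality := fun r s g => by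
        refine ModuleCat.hom_ext (LinearMap.ext fun f => funext fun j' => ?_)
        exact congrFun (sumMap_single k α.bar r s j f).symm j' }
  ι_π j j' := by
    split_ifs with h
    · subst h
      refine NatTrans.ext (funext fun r => ModuleCat.hom_ext (LinearMap.ext fun f => ?_))
      exact Pi.single_eq_same (M := fun j => IntervalSpace.{v, w} k (α.bar j) r) j f
    · refine NatTrans.ext (funext fun r => ModuleCat.hom_ext (LinearMap.ext fun f => ?_))
      exact Pi.single_eq_of_ne (M := fun j => IntervalSpace.{v, w} k (α.bar j) r) (Ne.symm h) f

lemma Barcode.sumBicone_total (α : Barcode P) :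
    ∑ j, (α.sumBicone.{v, w} k).π j ≫ (α.sumBicone.{v, w} k).ι j = 𝟙 (α.sumBicone.{v, w} k).pt := by
  refine NatTrans.ext (funext fun r => ModuleCat.hom_ext (LinearMap.ext fun f => ?_))
  rw [NatTrans.app_sum, ModuleCat.hom_sum, LinearMap.sum_apply]
  exact Finset.univ_sum_single (M := fun j => IntervalSpace.{v, w} k (α.bar j) r) f

/-- The pointwise product is the direct sum. -/
def Barcode.sumIso (α : Barcode P) :
    α.sumModule.{v, w} k ≅ ∐ fun j : Fin α.card => α.module.{v, w} k j :=
  IsColimit.coconePointUniqueUpToIso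
    (isBilimitOfTotal (α.sumBicone.{v, w} k) (α.sumBicone_total k)).isColimit
    (coproductIsCoproduct fun j : Fin α.card => α.module.{v, w} k j)

variable {k}

/-- The coproduct is computed pointwise by finite products, so a barcode decomposition becomes a
family of linear isomorphisms that can be checked on elements. -/
lemma isBarcodeOf_iff (α : Barcode P) (M : PersMod.{v, max v w} k P) :
    IsBarcodeOf.{v, w} α M ↔
      ∃ e : ∀ r, M.obj r ≃ₗ[k] ∀ j, IntervalSpace.{v, w} k (α.bar j) r,
        ∀ r s (h : r ≤ s) (x : M.obj r),
          e s ((M.map (homOfLE h)).hom x) = sumMap.{v, w} k α.bar r s (e r x) := by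
  constructor
  · rintro ⟨i⟩
    set i' := i ≪≫ (α.sumIso.{v, w} k).symm
    refine ⟨fun r => (i'.app r).toLinearEquiv, fun r s h x => ?_⟩
    exact LinearMap.congr_fun (ModuleCat.hom_ext_iff.mp (i'.hom.naturality (homOfLE h))) x
  · rintro ⟨e, he⟩
    refine ⟨NatIso.ofComponents (fun r => (e r).toModuleIso) (fun {r s} g => ?_) ≪≫ α.sumIso.{v, w} k⟩
    refine ModuleCat.hom_ext (LinearMap.ext fun x => ?_)
    exact he r s (leOfHom g) x

-- The map factors as a surjection onto the coordinates of the bars containing both `r` and `s`,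
-- followed by an injection.
omit [Preorder P] in
lemma finrank_range_sumMap {ι : Type} [Finite ι] (F : ι → Set P) (r s : P) :
    Module.finrank k (LinearMap.range (sumMap.{v, w} k F r s)) =
      Nat.card {j // r ∈ F j ∧ s ∈ F j} := by
  classical
  cases nonempty_fintype ι
  let J := {j // r ∈ F j ∧ s ∈ F j}
  let pr : (∀ j, IntervalSpace.{v, w} k (F j) r) →ₗ[k] (J → k) :=
    LinearMap.pi fun j => (LinearMap.proj (φ := fun _ : ULift (PLift (r ∈ F j.1)) => k) ⟨⟨j.2.1⟩⟩).comp (LinearMap.proj j.1)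
  let inc : (J → k) →ₗ[k] ∀ j, IntervalSpace.{v, w} k (F j) s :=
    LinearMap.pi fun j => LinearMap.pi fun hs =>
      if hr : r ∈ F j then LinearMap.proj ⟨j, hr, hs.down.down⟩ else 0
  have hcomp : sumMap.{v, w} k F r s = inc.comp pr := by
    refine LinearMap.ext fun f => funext fun j => funext fun hs => ?_
    by_cases hr : r ∈ F j <;> simp [sumMap, intervalMap, inc, pr, hr]
  have hpr : Function.Surjective pr := by
    intro g
    refine ⟨fun j hr => if hs : s ∈ F j then g ⟨j, hr.down.down, hs⟩ else 0, funext fun j => ?_⟩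
    simp [pr, j.2.2]
  have hinc : Function.Injective inc := by
    intro g g' h
    funext j
    simpa [inc, j.2.1] using congrFun (congrFun h j.1) ⟨⟨j.2.2⟩⟩
  rw [hcomp, LinearMap.range_comp_of_range_eq_top _ (LinearMap.range_eq_top.mpr hpr),
    LinearMap.finrank_range_of_inj hinc, Module.finrank_fintype_fun_eq_card, Nat.card_eq_fintype_card]

end IntervalSums

/-! ### Rank functions as counts of intervals -/

section Ranks

universe v w

variable {k : Type v} [Field k] {a c : ℝ}

/-- The part of the plane where the rank invariant of an interval module is one. -/
def tri (I : Set (Set.Icc a c)) : Set (ℝ × ℝ) :=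
  {p | p.1 ≤ p.2 ∧ p.1 ∈ Subtype.val '' I ∧ p.2 ∈ Subtype.val '' I}

lemma mk_mem_tri {I : Set (Set.Icc a c)} {r s : Set.Icc a c} (h : r ≤ s) :
    ((r : ℝ), (s : ℝ)) ∈ tri I ↔ r ∈ I ∧ s ∈ I := by
  simp [tri, h, r.2.1, r.2.2, s.2.1, s.2.2]

/-- The number of members of a family of intervals that contain both coordinates of `p`. -/
def rankCount {ι : Type*} (F : ι → Set (Set.Icc a c)) (p : ℝ × ℝ) : ℕ :=
  Nat.card {j // p ∈ tri (F j)}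

lemma rankInv_eq_rankCount {ι : Type} [Finite ι] (F : ι → Set (Set.Icc a c))
    (M : PersMod.{v, max v w} k (Set.Icc a c))
    (e : ∀ r, M.obj r ≃ₗ[k] ∀ j, IntervalSpace.{v, w} k (F j) r)
    (he : ∀ r s (h : r ≤ s) (x : M.obj r),
      e s ((M.map (homOfLE h)).hom x) = sumMap.{v, w} k F r s (e r x)) :
    rankInv M = rankCount F := by
  funext p
  unfold rankInv rankCount
  split_ifs with h
  · set r : Set.Icc a c := ⟨p.1, h.1⟩
    set s : Set.Icc a c := ⟨p.2, h.2.1⟩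
    have hrs : r ≤ s := h.2.2
    have h1 : ((M.map (homOfLE hrs)).hom) =
        ((e s).symm.toLinearMap ∘ₗ sumMap.{v, w} k F r s) ∘ₗ (e r).toLinearMap := by
      refine LinearMap.ext fun x => ?_
      simp [← he r s hrs]
    rw [h1, LinearMap.range_comp_of_range_eq_top _ (LinearEquiv.range _), LinearMap.range_comp,
      LinearEquiv.finrank_map_eq, finrank_range_sumMap]
    exact Nat.card_congr (Equiv.subtypeEquivRight fun j => (mk_mem_tri hrs).symm)
  · have : IsEmpty {j // p ∈ tri (F j)} := by
      refine ⟨fun ⟨j, hle, ⟨r, _, hr⟩, s, _, hs⟩ => h ?_⟩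
      exact ⟨hr ▸ r.2, hs ▸ s.2, hle⟩
    simp

lemma IsBarcodeOf.rankInv_eq {α : Barcode (Set.Icc a c)} {M : PersMod.{v, max v w} k (Set.Icc a c)}
    (h : IsBarcodeOf.{v, w} α M) : rankInv M = rankCount α.bar := by
  obtain ⟨e, he⟩ := (isBarcodeOf_iff α M).mp h
  exact rankInv_eq_rankCount α.bar M e he

open scoped Classical in
lemma rankInv_intervalModule (I : Set (Set.Icc a c)) (hI : I.OrdConnected) (p : ℝ × ℝ) :
    rankInv (intervalModule.{v, w} k I hI) p = if p ∈ tri I then 1 else 0 := by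
  rw [rankInv_eq_rankCount (fun _ : Unit => I) _
    (fun r => (LinearEquiv.funUnique Unit k (IntervalSpace.{v, w} k I r)).symm) fun _ _ _ _ => rfl]
  unfold rankCount
  split_ifs with h <;> simp [h]

lemma rankInv_zero (p : ℝ × ℝ) : rankInv (0 : PersMod.{v, w} k (Set.Icc a c)) p = 0 := by
  unfold rankInv
  split_ifs with h
  · have : (0 : PersMod.{v, w} k (Set.Icc a c)).map
        (homOfLE (show (⟨p.1, h.1⟩ : Set.Icc a c) ≤ ⟨p.2, h.2.1⟩ from h.2.2)) = 0 :=
      ((Functor.isZero_iff _).mp (isZero_zero _) _).eq_of_src _ _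
    rw [this, ModuleCat.hom_zero]
    exact (congrArg (fun S : Submodule k _ => Module.finrank k S) LinearMap.range_zero).trans
      (finrank_bot k _)
  · rfl

end Ranks

/-! ### The rank metric on interval modules -/

section IntervalDistance

universe v w

variable {k : Type v} [Field k] {a b c : ℝ}

/-- The rank distance between two interval modules, as the area of a symmetric difference. -/
def intervalDist (I J : Set (Set.Icc a c)) : ℝ≥0∞ :=
  volume (symmDiff (tri I) (tri J))

lemma intervalDist_comm (I J : Set (Set.Icc a c)) : intervalDist I J = intervalDist J I := by
  rw [intervalDist, symmDiff_comm, intervalDist]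

lemma intervalDist_self (I : Set (Set.Icc a c)) : intervalDist I I = 0 := by
  simp [intervalDist]

lemma intervalDist_triangle (I J L : Set (Set.Icc a c)) :
    intervalDist I L ≤ intervalDist I J + intervalDist J L :=
  measure_symmDiff_le _ _ _

lemma tri_empty : tri (∅ : Set (Set.Icc a c)) = ∅ := by
  simp [tri]

lemma measurableSet_tri {I : Set (Set.Icc a c)} (hI : I.OrdConnected) : MeasurableSet (tri I) := by
  have h : MeasurableSet (Subtype.val '' I : Set ℝ) :=
    measurableSet_Icc.subtype_image hI.measurableSet
  exact (measurableSet_le measurable_fst measurable_snd).inter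
    ((measurable_fst h).inter (measurable_snd h))

open scoped Classical in
lemma dRank_eq_volume_symmDiff {M N : PersMod.{v, w} k (Set.Icc a c)} {S T : Set (ℝ × ℝ)}
    (hS : MeasurableSet S) (hT : MeasurableSet T) (hM : ∀ p, rankInv M p = if p ∈ S then 1 else 0)
    (hN : ∀ p, rankInv N p = if p ∈ T then 1 else 0) : dRank M N = volume (symmDiff S T) := by
  rw [← lintegral_indicator_one (hS.symmDiff hT), dRank]
  refine lintegral_congr fun p => ?_
  rw [hM, hN]
  by_cases h1 : p ∈ S <;> by_cases h2 : p ∈ T <;> simp [Set.mem_symmDiff, h1, h2]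

lemma dRank_intervalModule {I J : Set (Set.Icc a c)} (hI : I.OrdConnected) (hJ : J.OrdConnected) :
    dRank (intervalModule.{v, w} k I hI) (intervalModule.{v, w} k J hJ) = intervalDist I J :=
  dRank_eq_volume_symmDiff (measurableSet_tri hI) (measurableSet_tri hJ)
    (rankInv_intervalModule I hI) (rankInv_intervalModule J hJ)

lemma dRank_intervalModule_zero {I : Set (Set.Icc a c)} (hI : I.OrdConnected) :
    dRank (intervalModule.{v, w} k I hI) 0 = intervalDist I ∅ := by
  rw [intervalDist, tri_empty]
  exact dRank_eq_volume_symmDiff (measurableSet_tri hI) MeasurableSet.empty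
    (rankInv_intervalModule I hI) (by simp [rankInv_zero])

lemma dRank_zero_intervalModule {I : Set (Set.Icc a c)} (hI : I.OrdConnected) :
    dRank 0 (intervalModule.{v, w} k I hI) = intervalDist ∅ I := by
  rw [intervalDist, tri_empty]
  exact dRank_eq_volume_symmDiff MeasurableSet.empty (measurableSet_tri hI)
    (by simp [rankInv_zero]) (rankInv_intervalModule I hI)

/-- The bar that is born at `x` and dies at `o` (never, if `o` is `none`). -/
def halfOpenBar (a c x : ℝ) (o : Option ℝ) : Set (Set.Icc a c) :=
  {r | x ≤ (r : ℝ) ∧ ∀ y ∈ o, (r : ℝ) < y}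

lemma ordConnected_halfOpenBar (x : ℝ) (o : Option ℝ) : (halfOpenBar a c x o).OrdConnected :=
  ⟨fun _ hr _ hs _ ht => ⟨hr.1.trans ht.1, fun y hy => lt_of_le_of_lt ht.2 (hs.2 y hy)⟩⟩

lemma mem_tri_halfOpenBar {x : ℝ} {o : Option ℝ} {p : ℝ × ℝ} :
    p ∈ tri (halfOpenBar a c x o) ↔ p.1 ≤ p.2 ∧ a ≤ p.1 ∧ p.2 ≤ c ∧ x ≤ p.1 ∧ ∀ y ∈ o, p.2 < y := by
  constructor
  · rintro ⟨h, ⟨r, hr, h1⟩, s, hs, h2⟩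
    exact ⟨h, h1 ▸ r.2.1, h2 ▸ s.2.2, h1 ▸ hr.1, h2 ▸ hs.2⟩
  · rintro ⟨h, h1, h2, h3, h4⟩
    exact ⟨h, ⟨⟨p.1, h1, h.trans h2⟩, ⟨h3, fun y hy => h.trans_lt (h4 y hy)⟩, rfl⟩,
      ⟨⟨p.2, h1.trans h, h2⟩, ⟨h3.trans h, h4⟩, rfl⟩⟩

lemma dRank_freeModule (x y : ℝ) :
    dRank (freeModule k a b x) (freeModule k a b y) =
      intervalDist (halfOpenBar a (2 * b - a) x none) (halfOpenBar a (2 * b - a) y none) := by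
  rw [freeModule, freeModule, dRank_intervalModule]
  simp [halfOpenBar]

/-- The rank distance between two bars that never die. -/
def freeDist (a b x y : ℝ) : ℝ≥0∞ :=
  intervalDist (halfOpenBar a (2 * b - a) x none) (halfOpenBar a (2 * b - a) y none)

lemma freeDist_comm (x y : ℝ) : freeDist a b x y = freeDist a b y x :=
  intervalDist_comm _ _

/-- The triangles of never-dying bars are nested, so the symmetric difference for `x` and `z` is the
disjoint union of the other two. -/
lemma freeDist_add_of_le {x y z : ℝ} (hxy : x ≤ y) (hyz : y ≤ z) :
    freeDist a b x y + freeDist a b y z = freeDist a b x z := by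
  simp only [freeDist, intervalDist]
  rw [← measure_union]
  · congr 1
    ext p
    simp only [Set.mem_union, Set.mem_symmDiff, mem_tri_halfOpenBar]
    have : y ≤ p.1 → x ≤ p.1 := hxy.trans
    have : z ≤ p.1 → y ≤ p.1 := hyz.trans
    tauto
  · rw [Set.disjoint_left]
    intro p
    simp only [Set.mem_symmDiff, mem_tri_halfOpenBar]
    have : y ≤ p.1 → x ≤ p.1 := hxy.trans
    have : z ≤ p.1 → y ≤ p.1 := hyz.trans
    tauto
  · exact (measurableSet_tri (ordConnected_halfOpenBar _ _)).symmDiff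
      (measurableSet_tri (ordConnected_halfOpenBar _ _))

lemma freeDist_convexComb {t : ℝ} (h0 : 0 ≤ t) (h1 : t ≤ 1) (x z : ℝ) :
    freeDist a b x ((1 - t) * x + t * z) + freeDist a b ((1 - t) * x + t * z) z =
      freeDist a b x z := by
  rcases le_total x z with h | h
  · exact freeDist_add_of_le (by nlinarith) (by nlinarith)
  · rw [freeDist_comm, freeDist_comm _ z, add_comm, freeDist_comm x z]
    exact freeDist_add_of_le (by nlinarith) (by nlinarith)

/-- A common death cuts both triangles by the same half-plane, which can only shrink the symmetric
difference. -/
lemma intervalDist_halfOpenBar_birth (x x' : ℝ) (o : Option ℝ) :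
    intervalDist (halfOpenBar a (2 * b - a) x o) (halfOpenBar a (2 * b - a) x' o) ≤
      freeDist a b x x' := by
  refine measure_mono fun p => ?_
  simp only [Set.mem_symmDiff, mem_tri_halfOpenBar]
  have (y : ℝ) (h : y ∈ (none : Option ℝ)) : p.2 < y := by simp at h
  tauto

/-- The shear `(r, s) ↦ (s, 2s - r)` compares a horizontal with a vertical strip. -/
lemma volume_strip_le {d d' : ℝ} (hd' : d' ≤ b) :
    volume {p : ℝ × ℝ | (a ≤ p.1 ∧ p.1 ≤ p.2) ∧ d ≤ p.2 ∧ p.2 < d'} ≤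
      volume {p : ℝ × ℝ | (p.1 ≤ p.2 ∧ p.2 ≤ 2 * b - a) ∧ d ≤ p.1 ∧ p.1 < d'} := by
  have hm : MeasurableSet {p : ℝ × ℝ | (p.1 ≤ p.2 ∧ p.2 ≤ 2 * b - a) ∧ d ≤ p.1 ∧ p.1 < d'} := by
    measurability
  rw [Measure.volume_eq_prod, Measure.prod_apply_symm (by measurability), Measure.prod_apply hm]
  refine lintegral_mono fun s => ?_
  -- After Fubini the slices at `s` lie in `[a, s]` and `[s, 2b - a]`. The reflection `r ↦ 2s - r`
  -- maps the first into the second because `s < d' ≤ b`.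
  rw [← (Measure.measurePreserving_sub_left volume (2 * s)).measure_preimage
    (measurable_prodMk_left hm).nullMeasurableSet]
  refine measure_mono ?_
  rintro r ⟨⟨h1, h2⟩, h3, h4⟩
  exact ⟨⟨by dsimp at *; linarith, by dsimp at *; linarith⟩, h3, h4⟩

/-- The two triangles differ only in a horizontal strip of heights between `d` and `d'`. By the
shear it is no larger than the vertical strip between `d` and `d'`, which `a ≤ d` keeps inside the
index range. -/
lemma intervalDist_halfOpenBar_death_of_le {x d d' : ℝ} (hd : a ≤ d) (hdd : d ≤ d') (hd' : d' ≤ b) :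
    intervalDist (halfOpenBar a (2 * b - a) x (some d)) (halfOpenBar a (2 * b - a) x (some d')) ≤
      freeDist a b d d' := by
  refine (measure_mono ?_).trans ((volume_strip_le (a := a) (d := d) hd').trans (measure_mono ?_))
  · intro p
    simp only [Set.mem_symmDiff, mem_tri_halfOpenBar, Option.mem_def, Option.some.injEq,
      forall_eq', Set.mem_ofPred_eq]
    rintro (⟨h, h'⟩ | ⟨h, h'⟩)
    · exact (h' ⟨h.1, h.2.1, h.2.2.1, h.2.2.2.1, h.2.2.2.2.trans_le hdd⟩).elim
    · refine ⟨⟨h.2.1, h.1⟩, not_lt.mp fun hlt => h' ?_, h.2.2.2.2⟩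
      exact ⟨h.1, h.2.1, h.2.2.1, h.2.2.2.1, hlt⟩
  · rintro p ⟨⟨h1, h2⟩, h3, h4⟩
    refine Or.inl ⟨mem_tri_halfOpenBar.mpr ⟨h1, hd.trans h3, h2, h3, by simp⟩, fun h => ?_⟩
    exact (mem_tri_halfOpenBar.mp h).2.2.2.1.not_gt h4

lemma intervalDist_halfOpenBar_some_le {x x' d d' : ℝ} (hd : d ∈ Set.Icc a b)
    (hd' : d' ∈ Set.Icc a b) :
    intervalDist (halfOpenBar a (2 * b - a) x (some d)) (halfOpenBar a (2 * b - a) x' (some d')) ≤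
      freeDist a b x x' + freeDist a b d d' := by
  refine (intervalDist_triangle _ (halfOpenBar a (2 * b - a) x' (some d)) _).trans
    (add_le_add (intervalDist_halfOpenBar_birth x x' _) ?_)
  rcases le_total d d' with h | h
  · exact intervalDist_halfOpenBar_death_of_le hd.1 h hd'.2
  · rw [intervalDist_comm, freeDist_comm]
    exact intervalDist_halfOpenBar_death_of_le hd'.1 h hd.2

end IntervalDistance

/-! ### Families of intervals with the same rank function -/

section Families

universe v

variable {a c : ℝ} {M N : Type*}

lemma rankCount_comp_equiv (A : N → Set (Set.Icc a c)) (e : M ≃ N) :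
    rankCount (A ∘ e) = rankCount A :=
  funext fun _ => Nat.card_congr (e.subtypeEquiv fun _ => Iff.rfl)

open scoped Classical in
/-- Finitely many intervals that do not contain `I` can be told apart from those that do by two
points of `I`. -/
lemma exists_testing_pair {I : Set (Set.Icc a c)} (hI : I.Nonempty) (S : Finset (Set (Set.Icc a c)))
    (hS : ∀ J ∈ S, J.OrdConnected) :
    ∃ r s : Set.Icc a c, r ≤ s ∧ ∀ J ∈ S, (r ∈ J ∧ s ∈ J) ↔ I ⊆ J := by
  obtain ⟨x, hx⟩ := hI
  have hf : ∀ J : Set (Set.Icc a c), ∃ y ∈ I, ¬ I ⊆ J → y ∉ J := by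
    intro J
    by_cases h : I ⊆ J
    · exact ⟨x, hx, fun h' => (h' h).elim⟩
    · obtain ⟨y, hy, hyJ⟩ := Set.not_subset.mp h
      exact ⟨y, hy, fun _ => hyJ⟩
  choose f hf hfJ using hf
  have hne : (insert x (S.image f)).Nonempty := Finset.insert_nonempty _ _
  have hsub : ∀ y ∈ insert x (S.image f), y ∈ I := by
    intro y hy
    rcases Finset.mem_insert.mp hy with rfl | hy
    · exact hx
    · obtain ⟨J, _, rfl⟩ := Finset.mem_image.mp hy
      exact hf J
  -- The extreme witnesses enclose all the others, so a convex `J` containing both contains its own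
  -- witness `f J`; this forces `I ⊆ J`.
  refine ⟨Finset.min' _ hne, Finset.max' _ hne, Finset.min'_le_max' _ hne, fun J hJ => ⟨?_, ?_⟩⟩
  · rintro ⟨h1, h2⟩
    by_contra h
    have hfm : f J ∈ insert x (S.image f) :=
      Finset.mem_insert_of_mem (Finset.mem_image_of_mem f hJ)
    exact hfJ J h ((hS J hJ).out h1 h2 ⟨Finset.min'_le _ _ hfm, Finset.le_max' _ _ hfm⟩)
  · exact fun h => ⟨h (hsub _ (Finset.min'_mem _ hne)), h (hsub _ (Finset.max'_mem _ hne))⟩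

-- A testing pair for all the intervals of both families turns containment of `I` into one value of
-- the rank function.
open scoped Classical in
lemma card_subset_eq [Fintype M] [Fintype N] {A : M → Set (Set.Icc a c)}
    {B : N → Set (Set.Icc a c)} (hA : ∀ m, (A m).OrdConnected) (hB : ∀ n, (B n).OrdConnected)
    (h : rankCount A = rankCount B) {I : Set (Set.Icc a c)} (hI : I.Nonempty) :
    (Finset.univ.filter fun m => I ⊆ A m).card = (Finset.univ.filter fun n => I ⊆ B n).card := by
  obtain ⟨r, s, hrs, hJ⟩ := exists_testing_pair hI
    (Finset.univ.image A ∪ Finset.univ.image B) (by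
      intro J hJ
      rcases Finset.mem_union.mp hJ with hJ | hJ <;> obtain ⟨m, -, rfl⟩ := Finset.mem_image.mp hJ
      exacts [hA m, hB m])
  have h1 := congrFun h (r, s)
  simp only [rankCount, mk_mem_tri hrs] at h1
  rw [Nat.card_eq_fintype_card, Nat.card_eq_fintype_card, Fintype.card_subtype,
    Fintype.card_subtype] at h1
  convert h1 using 3 with m _ n _
  · exact (hJ (A m) (by simp)).symm
  · exact (hJ (B n) (by simp)).symm

open scoped Classical in
lemma card_subset_eq_sum [Fintype M] (A : M → Set (Set.Icc a c)) (S : Finset (Set (Set.Icc a c)))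
    (hS : ∀ m, A m ∈ S) (I : Set (Set.Icc a c)) :
    (Finset.univ.filter fun m => I ⊆ A m).card =
      ∑ J ∈ S.filter (I ⊆ ·), (Finset.univ.filter fun m => A m = J).card := by
  rw [Finset.card_eq_sum_card_fiberwise (f := A) (t := S.filter (I ⊆ ·))
    fun m hm => by simpa [hS] using hm]
  refine Finset.sum_congr rfl fun J hJ => congrArg Finset.card ?_
  ext m
  simp only [Finset.mem_filter, Finset.mem_univ, true_and, and_iff_right_iff_imp]
  rintro rfl
  exact (Finset.mem_filter.mp hJ).2

open scoped Classical in
lemma card_subset_lt [Fintype M] {A : M → Set (Set.Icc a c)} {m : M} {J : Set (Set.Icc a c)}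
    (h : A m ⊂ J) : (Finset.univ.filter fun m' => J ⊆ A m').card <
      (Finset.univ.filter fun m' => A m ⊆ A m').card := by
  refine Finset.card_lt_card (Finset.ssubset_iff_of_subset ?_ |>.mpr ⟨m, by simp, ?_⟩)
  · exact Finset.monotone_filter_right _ fun m' _ h' => h.subset.trans h'
  · simpa using h.not_subset

-- Möbius inversion over inclusion: the multiplicity of `I` is the number of intervals containing
-- `I` minus the multiplicities of the strictly larger ones, known by induction on that number.
open scoped Classical in
lemma card_eq_eq [Fintype M] [Fintype N] {A : M → Set (Set.Icc a c)}
    {B : N → Set (Set.Icc a c)} (hA : ∀ m, (A m).OrdConnected) (hB : ∀ n, (B n).OrdConnected)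
    (h : rankCount A = rankCount B) (I : Set (Set.Icc a c)) (hI : I.Nonempty) :
    (Finset.univ.filter fun m => A m = I).card = (Finset.univ.filter fun n => B n = I).card := by
  induction hn : (Finset.univ.filter fun m => I ⊆ A m).card using Nat.strong_induction_on
    generalizing I with
  | _ n ih =>
    -- The induction parameter drops strictly for larger `J` only if `I` itself occurs; otherwise
    -- both multiplicities are zero.
    by_cases hex : (∃ m, A m = I) ∨ ∃ n, B n = I
    · have hlt : ∀ J, I ⊂ J → (Finset.univ.filter fun m => J ⊆ A m).card < n := by
        intro J hJ
        rcases hex with ⟨m, rfl⟩ | ⟨m, rfl⟩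
        · exact hn ▸ card_subset_lt hJ
        · rw [← hn, card_subset_eq hA hB h hI, card_subset_eq hA hB h (hI.mono hJ.subset)]
          exact card_subset_lt hJ
      have hsum := card_subset_eq hA hB h hI
      set S := insert I (Finset.univ.image A ∪ Finset.univ.image B) with hS
      rw [card_subset_eq_sum A S (by simp [hS]), card_subset_eq_sum B S (by simp [hS])] at hsum
      have hIS : I ∈ S.filter (I ⊆ ·) := by simp [hS]
      rw [← Finset.add_sum_erase _ _ hIS, ← Finset.add_sum_erase _ _ hIS] at hsum
      refine Nat.add_right_cancel (hsum.trans (congrArg _ (Finset.sum_congr rfl fun J hJ => ?_)))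
      have hIJ : I ⊂ J := by
        rw [Finset.mem_erase, Finset.mem_filter] at hJ
        exact hJ.2.2.ssubset_of_ne hJ.1.symm
      exact (ih _ (hlt J hIJ) J (hI.mono hIJ.subset) rfl).symm
    · push Not at hex
      simp [hex.1, hex.2]

lemma exists_equiv_nonempty [Finite M] [Finite N] {A : M → Set (Set.Icc a c)}
    {B : N → Set (Set.Icc a c)} (hA : ∀ m, (A m).OrdConnected) (hB : ∀ n, (B n).OrdConnected)
    (h : rankCount A = rankCount B) :
    ∃ e : {m // (A m).Nonempty} ≃ {n // (B n).Nonempty}, ∀ m, B (e m) = A m := by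
  classical
  cases nonempty_fintype M
  cases nonempty_fintype N
  have hfib : ∀ I, Nonempty ({m : {m // (A m).Nonempty} // A m = I} ≃
      {n : {n // (B n).Nonempty} // B n = I}) := by
    intro I
    by_cases hI : I.Nonempty
    · have h1 : Fintype.card {m // A m = I} = Fintype.card {n // B n = I} := by
        simpa only [Fintype.card_subtype] using card_eq_eq hA hB h I hI
      refine ⟨(Equiv.subtypeSubtypeEquivSubtype ?_).trans ((Fintype.equivOfCardEq h1).trans
        (Equiv.subtypeSubtypeEquivSubtype ?_).symm)⟩
      · rintro m rfl; exact hI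
      · rintro m rfl; exact hI
    · have h1 : IsEmpty {m : {m // (A m).Nonempty} // A m = I} := ⟨fun m => hI (m.2 ▸ m.1.2)⟩
      have h2 : IsEmpty {n : {n // (B n).Nonempty} // B n = I} := ⟨fun n => hI (n.2 ▸ n.1.2)⟩
      exact ⟨Equiv.equivOfIsEmpty _ _⟩
  exact ⟨Equiv.ofFiberEquiv (f := fun m : {m // (A m).Nonempty} => A m)
    (g := fun n : {n // (B n).Nonempty} => B n) fun I => (hfib I).some,
    fun m => Equiv.ofFiberEquiv_map (f := fun m : {m // (A m).Nonempty} => A m)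
      (g := fun n : {n // (B n).Nonempty} => B n) (fun I => (hfib I).some) m⟩

/-- Empty intervals are invisible to the rank function, but with a common index type their numbers
agree too, so the matching of nonempty intervals extends. -/
lemma exists_perm_of_rankCount_eq [Finite N] {A B : N → Set (Set.Icc a c)}
    (hA : ∀ m, (A m).OrdConnected) (hB : ∀ n, (B n).OrdConnected)
    (h : rankCount A = rankCount B) : ∃ π : Equiv.Perm N, ∀ m, B (π m) = A m := by
  classical
  obtain ⟨e, he⟩ := exists_equiv_nonempty hA hB h
  refine ⟨e.extendSubtype, fun m => ?_⟩
  by_cases hm : (A m).Nonempty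
  · rw [e.extendSubtype_apply_of_mem m hm]
    exact he ⟨m, hm⟩
  · have h2 := e.extendSubtype_not_mem m hm
    rw [Set.not_nonempty_iff_eq_empty.mp hm, Set.not_nonempty_iff_eq_empty.mp h2]

/-- The rank functions `F` and `G` are those of two families of intervals with the common finite
index type `N`, and the bijective matching given by the indices costs at most `C`. -/
def RankCoupling (N : Type*) [Fintype N] (F G : ℝ × ℝ → ℕ) (a c : ℝ) (C : ℝ≥0∞) : Prop :=
  ∃ A B : N → Set (Set.Icc a c), (∀ p, (A p).OrdConnected) ∧ (∀ p, (B p).OrdConnected) ∧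
    rankCount A = F ∧ rankCount B = G ∧ ∑ p, intervalDist (A p) (B p) ≤ C

/-- The two middle families have the same rank function, hence agree up to a permutation, and the
triangle inequality applies index by index. -/
lemma RankCoupling.trans [Fintype N] {F G H : ℝ × ℝ → ℕ} {C C' : ℝ≥0∞}
    (h : RankCoupling N F G a c C) (h' : RankCoupling N G H a c C') :
    RankCoupling N F H a c (C + C') := by
  obtain ⟨A, B, hA, hB, hAF, hBG, hC⟩ := h
  obtain ⟨A', B', hA', hB', hAG, hBH, hC'⟩ := h'
  obtain ⟨π, hπ⟩ := exists_perm_of_rankCount_eq hB hA' (hBG.trans hAG.symm)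
  refine ⟨A, B' ∘ π, hA, fun p => hB' _, hAF, (rankCount_comp_equiv B' π).trans hBH, ?_⟩
  calc ∑ p, intervalDist (A p) (B' (π p))
      ≤ ∑ p, (intervalDist (A p) (B p) + intervalDist (A' (π p)) (B' (π p))) :=
        Finset.sum_le_sum fun p _ => hπ p ▸ intervalDist_triangle _ _ _
    _ = ∑ p, intervalDist (A p) (B p) + ∑ p, intervalDist (A' p) (B' p) := by
        rw [Finset.sum_add_distrib, Equiv.sum_comp π fun p => intervalDist (A' p) (B' p)]
    _ ≤ C + C' := add_le_add hC hC'

/-- The bars of `α` and `β` are the nonempty members of the two families. Bars with the same index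
are matched, and an empty partner stands for the diagonal. -/
lemma RankCoupling.W1Rank_le (k : Type v) [Field k] [Fintype N] {α β : Barcode (Set.Icc a c)}
    {C : ℝ≥0∞} (h : RankCoupling N (rankCount α.bar) (rankCount β.bar) a c C) :
    W1Rank k α β ≤ C := by
  classical
  obtain ⟨A, B, hA, hB, hAα, hBβ, hC⟩ := h
  refine le_trans ?_ hC
  obtain ⟨f, hf⟩ := exists_equiv_nonempty α.ordConnected hA hAα.symm
  obtain ⟨g, hg⟩ := exists_equiv_nonempty β.ordConnected hB hBβ.symm
  let e := (Equiv.subtypeUnivEquiv α.nonempty).symm.trans f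
  let e' := (Equiv.subtypeUnivEquiv β.nonempty).symm.trans g
  have he : ∀ i, A (e i) = α.bar i := fun i => hf ⟨i, α.nonempty i⟩
  have he' : ∀ j, B (e' j) = β.bar j := fun j => hg ⟨j, β.nonempty j⟩
  let γ : Fin α.card ≃. Fin β.card :=
    { toFun := fun i => if h : (B (e i)).Nonempty then some (e'.symm ⟨e i, h⟩) else none
      invFun := fun j => if h : (A (e' j)).Nonempty then some (e.symm ⟨e' j, h⟩) else none
      inv := by
        intro i j
        simp only [Option.dite_none_right_eq_some, Option.some.injEq]
        constructor
        · rintro ⟨h, rfl⟩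
          have : (e (e.symm ⟨(e' j : N), h⟩) : N) = e' j := by simp
          exact ⟨by rw [this]; exact (e' j).2,
            by rw [Equiv.symm_apply_eq]; exact Subtype.ext this⟩
        · rintro ⟨h, rfl⟩
          have : (e' (e'.symm ⟨(e i : N), h⟩) : N) = e i := by simp
          exact ⟨by rw [this]; exact (e i).2,
            by rw [Equiv.symm_apply_eq]; exact Subtype.ext this⟩ }
  refine (iInf_le _ γ).trans ?_
  have h1 : ∀ i, (match γ i with
      | some j => dRank (α.module.{v, v} k i) (β.module.{v, v} k j)
      | none => dRank (α.module.{v, v} k i) 0) = intervalDist (A (e i)) (B (e i)) := by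
    intro i
    by_cases h : (B (e i)).Nonempty
    · have hγ : γ i = some (e'.symm ⟨e i, h⟩) := dif_pos h
      rw [hγ]
      change dRank (intervalModule k _ _) (intervalModule k _ _) = _
      rw [dRank_intervalModule, he, ← he' (e'.symm ⟨e i, h⟩)]
      simp
    · have hγ : γ i = none := dif_neg h
      rw [hγ]
      change dRank (intervalModule k _ _) 0 = _
      rw [dRank_intervalModule_zero, he, Set.not_nonempty_iff_eq_empty.mp h]
  have h2 : ∀ j, (match γ.symm j with
      | some _ => 0
      | none => dRank 0 (β.module.{v, v} k j)) =
        if (A (e' j)).Nonempty then 0 else intervalDist (A (e' j)) (B (e' j)) := by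
    intro j
    by_cases h : (A (e' j)).Nonempty
    · have hγ : γ.symm j = some (e.symm ⟨e' j, h⟩) := dif_pos h
      rw [hγ, if_pos h]
    · have hγ : γ.symm j = none := dif_neg h
      rw [hγ, if_neg h]
      change dRank 0 (intervalModule k _ _) = _
      rw [dRank_zero_intervalModule, he', Set.not_nonempty_iff_eq_empty.mp h]
  have hcost : matchingCost k α β γ = ∑ i, intervalDist (A (e i)) (B (e i)) +
      ∑ j, if (A (e' j)).Nonempty then 0 else intervalDist (A (e' j)) (B (e' j)) :=
    congrArg₂ (· + ·) (Finset.sum_congr rfl fun i _ => h1 i) (Finset.sum_congr rfl fun j _ => h2 j)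
  rw [hcost, Equiv.sum_comp e fun p => intervalDist (A p) (B p),
    Equiv.sum_comp e' fun p => if (A p).Nonempty then 0 else intervalDist (A p) (B p),
    -- Indices with `A p` nonempty are charged to the bars of `α`, the others to unmatched bars of
    -- `β`; indices where both are empty cost nothing.
    ← Finset.sum_filter_add_sum_filter_not Finset.univ fun p => (A p).Nonempty]
  refine add_le_add (le_of_eq ?_) ?_
  · exact (Finset.sum_subtype _ (by simp) fun p => intervalDist (A p) (B p)).symm
  · rw [Finset.sum_filter, ← Finset.sum_subtype (Finset.univ.filter fun p => (B p).Nonempty) (by simp)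
      fun p => if (A p).Nonempty then 0 else intervalDist (A p) (B p)]
    simp only [ite_not]
    exact Finset.sum_le_sum_of_subset (Finset.subset_univ _)

end Families

/-! ### Barcodes of weighted complexes -/

section PersistencePairing

open RelCWComplex

universe u v

variable {X : Type u} [TopologicalSpace X] [T2Space X] {K : Set X} [CWComplex K]
  [CWComplex.Finite K] {k : Type v} [Field k] {a b : ℝ}

variable (K k) in
/-- The cycles of the whole complex. -/
def allCycles : (n : ℕ) → Submodule k (cell K n → k)
  | 0 => ⊤
  | n + 1 => LinearMap.ker (boundary K k n)

lemma cycles_eq_supportedOn_inf (E : Subcomplex K) (n : ℕ) :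
    cycles k E n = supportedOn k (E.I n) ⊓ allCycles K k n := by
  cases n with
  | zero => exact (inf_top_eq _).symm
  | succ n => rfl

open scoped Classical in
/-- The intervals, indexed by the `i`-cells, that are determined by the set `P` of the cells that
create a class and by the cells `τ p` that kill the classes. -/
def pairingBars (w : Weight K a b) {i : ℕ} (P : Set (cell K i)) (τ : cell K i → Option (cell K (i + 1)))
    (p : cell K i) : Set (Set.Icc a (2 * b - a)) :=
  if p ∈ P then halfOpenBar a (2 * b - a) (w.val i p) ((τ p).map (w.val (i + 1))) else ∅

omit [T2Space X] [CWComplex.Finite K] in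
lemma ordConnected_pairingBars (w : Weight K a b) {i : ℕ} (P : Set (cell K i))
    (τ : cell K i → Option (cell K (i + 1))) (p : cell K i) :
    (pairingBars w P τ p).OrdConnected := by
  unfold pairingBars
  split_ifs
  · exact ordConnected_halfOpenBar _ _
  · exact Set.ordConnected_empty

omit [T2Space X] [CWComplex.Finite K] in
lemma mem_pairingBars {w : Weight K a b} {i : ℕ} {P : Set (cell K i)}
    {τ : cell K i → Option (cell K (i + 1))} {p : cell K i} {r : Set.Icc a (2 * b - a)} :
    r ∈ pairingBars w P τ p ↔
      p ∈ P ∧ w.val i p ≤ r ∧ ∀ t, τ p = some t → (r : ℝ) < w.val (i + 1) t := by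
  unfold pairingBars
  split_ifs with h <;> simp [h, halfOpenBar]

lemma rankCount_subtype_nonempty {N : Type*} {c : ℝ} (F : N → Set (Set.Icc a c)) :
    rankCount (fun j : {j // (F j).Nonempty} => F j) = rankCount F :=
  funext fun p => Nat.card_congr (Equiv.subtypeSubtypeEquivSubtype (q := fun j => p ∈ tri (F j))
    fun h => Set.image_nonempty.mp ⟨_, h.2.1⟩)

/-- An adapted basis of the cycles yields the barcode of the persistent homology. -/
theorem exists_isBarcodeOf_of_adapted_basis (w : Weight K a b) (i : ℕ) (P : Set (cell K i))
    (β : Module.Basis (cell K i) k (cell K i → k)) (τ : cell K i → Option (cell K (i + 1)))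
    (hZ : ∀ r x, x ∈ cycles k (w.sublevel r) i ↔ ∀ p, β.repr x p ≠ 0 → w.val i p ≤ r ∧ p ∈ P)
    (hB : ∀ r, ∀ x ∈ cycles k (w.sublevel r) i, x ∈ boundaries k (w.sublevel r) i ↔
      ∀ p, β.repr x p ≠ 0 → ∃ t, w.val (i + 1) t ≤ r ∧ τ p = some t) :
    ∃ α : Barcode (Set.Icc a (2 * b - a)), IsBarcodeOf.{v, u} α (w.persHomology k i) ∧
      rankCount α.bar = rankCount (pairingBars w P τ) := by
  classical
  set F := pairingBars w P τ with hF
  let n := Fintype.card {p // (F p).Nonempty}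
  let g : Fin n ≃ {p // (F p).Nonempty} := (Fintype.equivFin _).symm
  let α : Barcode (Set.Icc a (2 * b - a)) :=
    { card := n
      bar := fun j => F (g j)
      ordConnected := fun j => ordConnected_pairingBars w P τ _
      nonempty := fun j => (g j).2 }
  refine ⟨α, ?_, ?_⟩
  -- `L r` reads off the coordinates of a cycle at the bars alive at `r`. Its kernel consists of the
  -- cycles all of whose coordinates have been killed by `r`, that is, the boundaries. The argument
  -- only needs boundaries intersected with cycles, not that the boundary map squares to zero.
  · let L : ∀ r : Set.Icc a (2 * b - a), cycles k (w.sublevel r) i →ₗ[k]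
        ∀ j, IntervalSpace.{v, u} k (α.bar j) r := fun r =>
      LinearMap.pi fun j => LinearMap.pi fun _ => (β.coord (g j)).comp (Submodule.subtype _)
    have hL : ∀ r x j h, L r x j h = β.repr x (g j) := fun r x j h => rfl
    have hker : ∀ r : Set.Icc a (2 * b - a), (boundaries k (w.sublevel r) i).comap (cycles k (w.sublevel r) i).subtype =
        LinearMap.ker (L r) := by
      intro r
      ext x
      rw [Submodule.mem_comap, Submodule.subtype_apply, hB r x x.2, LinearMap.mem_ker]
      constructor
      · intro h
        funext j hj
        rw [hL]
        by_contra h0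
        obtain ⟨t, ht, hτ⟩ := h _ h0
        exact ((mem_pairingBars.mp hj.down.down).2.2 t hτ).not_ge ht
      · intro h p hp
        by_contra! hcon
        obtain ⟨h1, h2⟩ := (hZ r x).mp x.2 p hp
        have hr : r ∈ F p := mem_pairingBars.mpr
          ⟨h2, h1, fun t ht => not_le.mp fun hle => hcon t hle ht⟩
        have h3 := congrFun (congrFun h (g.symm ⟨p, r, hr⟩))
          ⟨⟨by simpa [α] using hr⟩⟩
        rw [hL] at h3
        exact hp (by simpa using h3)
    have hsurj : ∀ r, Function.Surjective (L r) := by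
      intro r f
      let c : cell K i → k := fun p =>
        if h : r ∈ F p then f (g.symm ⟨p, r, h⟩) ⟨⟨by simpa [α] using h⟩⟩ else 0
      have hc : ∀ p, β.repr (β.equivFun.symm c) p = c p := fun p => by
        rw [← Module.Basis.equivFun_apply, LinearEquiv.apply_symm_apply]
      refine ⟨⟨β.equivFun.symm c, (hZ r _).mpr fun p hp => ?_⟩, funext fun j => funext fun hj => ?_⟩
      · rw [hc] at hp
        have hr : r ∈ F p := by
          by_contra h
          exact hp (dif_neg h)
        exact ⟨(mem_pairingBars.mp hr).2.1, (mem_pairingBars.mp hr).1⟩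
      · have key : ∀ q (hq : g.symm q = j) (h : r ∈ F q) (h' : r ∈ α.bar (g.symm q)),
            f (g.symm q) ⟨⟨h'⟩⟩ = f j hj := by
          rintro q rfl h h'
          rfl
        rw [hL, hc]
        refine (dif_pos (show r ∈ F (g j) from hj.down.down)).trans ?_
        exact key (g j) (by simp) hj.down.down _
    rw [isBarcodeOf_iff]
    refine ⟨fun r => (Submodule.quotEquivOfEq _ _ (hker r)).trans
      ((L r).quotKerEquivOfSurjective (hsurj r)), fun r s hrs x => ?_⟩
    obtain ⟨x, rfl⟩ := Submodule.Quotient.mk_surjective _ x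
    change L s (Submodule.inclusion (cycles_mono k (w.sublevel_mono hrs) i) x) =
      sumMap.{v, u} k α.bar r s (L r x)
    funext j hj
    have hs : s ∈ F (g j) := hj.down.down
    -- A bar alive at `s` but not at the earlier `r` is not yet born at `r`, so a cycle at `r` has
    -- coordinate zero there.
    change β.repr x (g j) = if hr : r ∈ F (g j) then β.repr x (g j) else 0
    split_ifs with hr
    · rfl
    · by_contra h0
      obtain ⟨h1, h2⟩ := (hZ r x).mp x.2 _ h0
      exact hr (mem_pairingBars.mpr ⟨h2, h1, fun t ht =>
        lt_of_le_of_lt (show (r : ℝ) ≤ s from hrs) ((mem_pairingBars.mp hs).2.2 t ht)⟩)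
  · rw [← rankCount_subtype_nonempty F]
    exact rankCount_comp_equiv (fun j : {j // (F j).Nonempty} => F j) g

/-- For a given linear order on the cells there is a pairing that yields the barcodes of all the
weights that are monotone for this order. -/
theorem exists_pairing (o : ∀ n, LinearOrder (cell K n)) (i : ℕ) :
    ∃ τ : cell K i → Option (cell K (i + 1)),
      (∀ p q t, τ p = some t → τ q = some t → p = q) ∧
      (∀ p t, τ p = some t → t ∉ leads (allCycles K k (i + 1))) ∧
      ∀ w : Weight K a b, (∀ n, Monotone (w.val n)) →
        ∃ α : Barcode (Set.Icc a (2 * b - a)), IsBarcodeOf.{v, u} α (w.persHomology k i) ∧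
          rankCount α.bar = rankCount (pairingBars w (leads (allCycles K k i)) τ) := by
  obtain ⟨β, τ, h1, h2, h3, h4⟩ := exists_adapted_basis (boundary K k i) (allCycles K k i)
  refine ⟨τ, h3, fun p t ht => (h4 p t ht).2, fun w hw => ?_⟩
  have hlow : ∀ n r, IsLowerSet {σ | w.val n σ ≤ r} := fun n r σ ρ hle hσ => (hw n hle).trans hσ
  refine exists_isBarcodeOf_of_adapted_basis w i _ β τ (fun r x => ?_) fun r x hx => ?_
  · rw [cycles_eq_supportedOn_inf]
    exact h1 _ (hlow i r) x
  · rw [cycles_eq_supportedOn_inf] at hx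
    refine Iff.trans ?_ (h2 _ (hlow (i + 1) r) x)
    exact ⟨fun h => ⟨h, hx.2⟩, fun h => h.1⟩

end PersistencePairing

/-! ### Linear interpolation of weights -/

section Inversions

variable {S : Type*}

/-- Order lexicographically by the value of `f`, with ties decided by a well-order. -/
lemma exists_linearOrder_monotone (f : S → ℝ) :
    ∃ o : LinearOrder S, ∀ p q, o.le p q → f p ≤ f q := by
  classical
  let _ : LinearOrder S := linearOrderOfSTO WellOrderingRel
  refine ⟨LinearOrder.lift' (fun s => toLex (f s, s)) fun p q h => ?_, fun p q h => ?_⟩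
  · exact congrArg Prod.snd (toLex.injective h)
  · exact Prod.Lex.monotone_fst _ _ h

/-- The pairs that are strictly ordered by `f` and by `g` in opposite ways. -/
def inversions (f g : S → ℝ) : Set (S × S) :=
  {p | f p.1 < f p.2 ∧ g p.2 < g p.1}

/-- Without inversions an order that is monotone for `f + g` is monotone for both, which supplies
the common order of two weights. -/
lemma le_and_le_of_add_le {f g : S → ℝ} (h : inversions f g = ∅) {p q : S}
    (hpq : f p + g p ≤ f q + g q) : f p ≤ f q ∧ g p ≤ g q := by
  have h1 : ∀ p q, f p < f q → g p ≤ g q := fun p q hf =>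
    not_lt.mp fun hg => (h ▸ (show (p, q) ∈ inversions f g from ⟨hf, hg⟩) : (p, q) ∈ (∅ : Set _))
  constructor
  · by_contra! hf
    linarith [h1 q p hf]
  · by_contra! hg
    rcases lt_or_ge (f p) (f q) with hf | hf
    · linarith [h1 p q hf]
    · linarith

/-- Up to the time of the first crossing no pair is inverted, and at that time a pair ceases to be
inverted. -/
lemma exists_first_crossing [Finite S] {f g : S → ℝ} (h : (inversions f g).Nonempty) :
    ∃ t : ℝ, 0 ≤ t ∧ t ≤ 1 ∧ inversions f (fun σ => (1 - t) * f σ + t * g σ) = ∅ ∧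
      (inversions (fun σ => (1 - t) * f σ + t * g σ) g).ncard < (inversions f g).ncard := by
  -- The minimised quotient is the time at which the interpolated values of the pair agree.
  obtain ⟨⟨σ, τ⟩, ⟨hf, hg⟩, hmin⟩ := Set.exists_min_image (inversions f g)
    (fun p => (f p.2 - f p.1) / ((f p.2 - f p.1) + (g p.1 - g p.2))) (Set.toFinite _) h
  dsimp only at hf hg hmin
  set t := (f τ - f σ) / ((f τ - f σ) + (g σ - g τ)) with ht
  have hpos : 0 < (f τ - f σ) + (g σ - g τ) := by linarith
  have ht0 : 0 ≤ t := div_nonneg (by linarith) hpos.le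
  have ht1 : t ≤ 1 := (div_le_one hpos).mpr (by linarith)
  have hcross : t * ((f τ - f σ) + (g σ - g τ)) = f τ - f σ := div_mul_cancel₀ _ hpos.ne'
  refine ⟨t, ht0, ht1, ?_, ?_⟩
  · refine Set.eq_empty_iff_forall_notMem.mpr ?_
    rintro ⟨ρ, κ⟩ ⟨h1, h2⟩
    dsimp only at h1 h2
    have hg' : g κ < g ρ := by
      by_contra! hcon
      nlinarith [mul_nonneg (sub_nonneg.mpr ht1) (sub_nonneg.mpr h1.le),
        mul_nonneg ht0 (sub_nonneg.mpr hcon)]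
    -- This pair does not tie before time `t`, by minimality, so it cannot already be strictly
    -- reversed at `t`.
    have hle := hmin (ρ, κ) ⟨h1, hg'⟩
    rw [le_div_iff₀ (by dsimp only; linarith)] at hle
    dsimp only at hle
    linarith
  · refine Set.ncard_lt_ncard (Set.ssubset_iff_of_subset ?_ |>.mpr ⟨(σ, τ), ⟨hf, hg⟩, ?_⟩)
      (Set.toFinite _)
    · rintro ⟨ρ, κ⟩ ⟨h1, h2⟩
      refine ⟨?_, h2⟩
      dsimp only at h1 h2 ⊢
      by_contra! hcon
      nlinarith [mul_nonneg (sub_nonneg.mpr ht1) (sub_nonneg.mpr hcon),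
        mul_nonneg ht0 (sub_nonneg.mpr h2.le)]
    · rintro ⟨h1, -⟩
      dsimp only at h1
      linarith

end Inversions

/-! ### Cellwise couplings and the stability estimate -/

section Stability

open RelCWComplex

universe u v

variable {X : Type u} [TopologicalSpace X] [T2Space X] {K : Set X} [CWComplex K] {a b : ℝ}

/-- The convex combination of two weights. -/
def Weight.convexComb (w v : Weight K a b) (t : ℝ) (h0 : 0 ≤ t) (h1 : t ≤ 1) : Weight K a b where
  val n σ := (1 - t) * w.val n σ + t * v.val n σ
  mem_Icc n σ := convex_Icc a b (w.mem_Icc n σ) (v.mem_Icc n σ) (sub_nonneg.mpr h1) h0 (by ring)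
  mono m n σ τ h := add_le_add
    (mul_le_mul_of_nonneg_left (w.mono m n σ τ h) (sub_nonneg.mpr h1))
    (mul_le_mul_of_nonneg_left (v.mono m n σ τ h) h0)

/-- The distance of the free modules generated by a cell for two weights. -/
def Weight.cellDist (w v : Weight K a b) (n : ℕ) (σ : cell K n) : ℝ≥0∞ :=
  freeDist a b (w.val n σ) (v.val n σ)

variable [CWComplex.Finite K]

-- Each bar is charged to its creating cell in `P` and to its killing cell outside `Q`; injectivity
-- of the pairing charges every killing cell at most once.
omit [T2Space X] in
lemma sum_intervalDist_pairingBars_le (w v : Weight K a b) {i : ℕ} (P : Set (cell K i))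
    (Q : Set (cell K (i + 1))) {τ : cell K i → Option (cell K (i + 1))}
    (hinj : ∀ p q t, τ p = some t → τ q = some t → p = q) (hQ : ∀ p t, τ p = some t → t ∉ Q) :
    ∑ p, intervalDist (pairingBars w P τ p) (pairingBars v P τ p) ≤
      ∑ p, P.indicator (w.cellDist v i) p + ∑ t, Qᶜ.indicator (w.cellDist v (i + 1)) t := by
  classical
  have hbar : ∀ p, intervalDist (pairingBars w P τ p) (pairingBars v P τ p) ≤
      P.indicator (w.cellDist v i) p +
        ∑ t, if τ p = some t then Qᶜ.indicator (w.cellDist v (i + 1)) t else 0 := by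
    intro p
    by_cases hp : p ∈ P
    · rw [Set.indicator_of_mem hp, pairingBars, pairingBars, if_pos hp, if_pos hp]
      rcases hτ : τ p with _ | t
      · exact (intervalDist_halfOpenBar_birth _ _ _).trans le_self_add
      · refine (intervalDist_halfOpenBar_some_le (w.mem_Icc _ t) (v.mem_Icc _ t)).trans ?_
        simp only [Option.some.injEq, Finset.sum_ite_eq, Finset.mem_univ, if_true]
        rw [Set.indicator_of_mem (show t ∈ Qᶜ from hQ p t hτ)]
        rfl
    · rw [pairingBars, pairingBars, if_neg hp, if_neg hp, intervalDist_self]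
      exact zero_le
  refine (Finset.sum_le_sum fun p _ => hbar p).trans ?_
  rw [Finset.sum_add_distrib, Finset.sum_comm]
  refine add_le_add le_rfl (Finset.sum_le_sum fun t _ => ?_)
  by_cases ht : ∃ p, τ p = some t
  · obtain ⟨p, hp⟩ := ht
    rw [Finset.sum_eq_single p (fun q _ hq => if_neg fun h => hq (hinj q p t h hp)) (by simp),
      if_pos hp]
  · push Not at ht
    simp [ht]

variable (k : Type v) [Field k]

/-- The persistent homologies of `w` and `v` have barcodes, indexed by cells, at total distance at
most `C i` in each degree `i`, where `C` satisfies the two bounds of the stability theorem. -/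
def HasCellwiseCoupling (w v : Weight K a b) : Prop :=
  ∃ C : ℕ → ℝ≥0∞,
    (∀ i, RankCoupling (cell K i) (rankInv (w.persHomology k i)) (rankInv (v.persHomology k i))
      a (2 * b - a) (C i)) ∧
    (∀ i, C i ≤ ∑ σ, w.cellDist v i σ + ∑ σ, w.cellDist v (i + 1) σ) ∧
    ∑' i, C i ≤ ∑' i, ∑ σ, w.cellDist v i σ

variable {k}

/-- Ordering the cells by `w + v` makes both weights monotone, so a single pairing serves both
barcodes. -/
lemma hasCellwiseCoupling_of_inversions_eq_empty {w v : Weight K a b}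
    (h : inversions (fun σ : Σ n, cell K n => w.val σ.1 σ.2) (fun σ => v.val σ.1 σ.2) = ∅) :
    HasCellwiseCoupling k w v := by
  choose o ho using fun n => exists_linearOrder_monotone fun σ : cell K n => w.val n σ + v.val n σ
  have hwv : ∀ n p q, (o n).le p q → w.val n p ≤ w.val n q ∧ v.val n p ≤ v.val n q :=
    fun n p q hpq => le_and_le_of_add_le h (p := ⟨n, p⟩) (q := ⟨n, q⟩) (ho n p q hpq)
  set P := fun n => leads (allCycles K k n)
  refine ⟨fun i => ∑ p, (P i).indicator (w.cellDist v i) p +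
    ∑ t, (P (i + 1))ᶜ.indicator (w.cellDist v (i + 1)) t, fun i => ?_, fun i => ?_, ?_⟩
  · obtain ⟨τ, hinj, hτ, hbar⟩ := exists_pairing (k := k) (a := a) (b := b) o i
    obtain ⟨α, hα, hαr⟩ := hbar w fun n p q hpq => (hwv n p q hpq).1
    obtain ⟨β, hβ, hβr⟩ := hbar v fun n p q hpq => (hwv n p q hpq).2
    exact ⟨_, _, ordConnected_pairingBars w _ τ, ordConnected_pairingBars v _ τ,
      hαr.symm.trans hα.rankInv_eq.symm, hβr.symm.trans hβ.rankInv_eq.symm,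
      sum_intervalDist_pairingBars_le w v _ _ hinj hτ⟩
  · exact add_le_add (Finset.sum_le_sum fun p _ => Set.indicator_le_self _ _ p)
      (Finset.sum_le_sum fun p _ => Set.indicator_le_self _ _ p)
  -- The deaths of degree `i` are charged in dimension `i + 1`, so their shifted sum is at most the
  -- sum over all dimensions. Each cell is then counted once, in `P i` or in its complement.
  · rw [ENNReal.tsum_add]
    refine (add_le_add le_rfl (ENNReal.tsum_comp_le_tsum_of_injective (add_left_injective 1)
      fun i => ∑ t, (P i)ᶜ.indicator (w.cellDist v i) t)).trans ?_
    rw [← ENNReal.tsum_add]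
    refine ENNReal.tsum_le_tsum fun i => ?_
    rw [← Finset.sum_add_distrib]
    exact Finset.sum_le_sum fun p _ => (Set.indicator_self_add_compl_apply _ _ p).le

lemma HasCellwiseCoupling.trans {w u v : Weight K a b} (h : HasCellwiseCoupling k w u)
    (h' : HasCellwiseCoupling k u v)
    (hadd : ∀ n σ, w.cellDist u n σ + u.cellDist v n σ = w.cellDist v n σ) :
    HasCellwiseCoupling k w v := by
  obtain ⟨C, h1, h2, h3⟩ := h
  obtain ⟨C', h1', h2', h3'⟩ := h'
  refine ⟨fun i => C i + C' i, fun i => (h1 i).trans (h1' i), fun i => ?_, ?_⟩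
  · refine (add_le_add (h2 i) (h2' i)).trans (le_of_eq ?_)
    rw [add_add_add_comm, ← Finset.sum_add_distrib, ← Finset.sum_add_distrib]
    simp only [hadd]
  · rw [ENNReal.tsum_add]
    refine (add_le_add h3 h3').trans (le_of_eq ?_)
    rw [← ENNReal.tsum_add]
    simp only [← Finset.sum_add_distrib, hadd]

/-- Induction on the number of inversions with `v` fixed: go straight from `w` to the weight at the
first crossing, then apply the hypothesis from there. -/
theorem hasCellwiseCoupling (w v : Weight K a b) : HasCellwiseCoupling k w v := by
  have : Finite (Σ n, cell K n) := finite_cells_of_finite (C := K)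
  induction hn : (inversions (fun σ : Σ n, cell K n => w.val σ.1 σ.2)
    (fun σ => v.val σ.1 σ.2)).ncard using Nat.strong_induction_on generalizing w with
  | _ n ih =>
    rcases Set.eq_empty_or_nonempty (inversions (fun σ : Σ n, cell K n => w.val σ.1 σ.2)
      (fun σ => v.val σ.1 σ.2)) with h | h
    · exact hasCellwiseCoupling_of_inversions_eq_empty h
    · obtain ⟨t, h0, h1, hempty, hlt⟩ := exists_first_crossing h
      exact (hasCellwiseCoupling_of_inversions_eq_empty (v := w.convexComb v t h0 h1) hempty).trans
        (ih _ (hn ▸ hlt) (w.convexComb v t h0 h1) rfl) fun n σ => freeDist_convexComb h0 h1 _ _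

theorem exists_isBarcodeOf_persHomology (w : Weight K a b) (i : ℕ) :
    ∃ α : Barcode (Set.Icc a (2 * b - a)), IsBarcodeOf.{v, u} α (w.persHomology k i) := by
  choose o ho using fun n => exists_linearOrder_monotone (w.val n)
  obtain ⟨τ, -, -, hbar⟩ := exists_pairing (k := k) (a := a) (b := b) o i
  obtain ⟨α, hα, -⟩ := hbar w ho
  exact ⟨α, hα⟩

end Stability

end WeightedCW

end

theorem mainTheorem1
    {X : Type*} [TopologicalSpace X] [T2Space X]
    (K : Set X) [CWComplex K] [CWComplex.Finite K]
    (k : Type*) [Field k] (a b : ℝ) (w v : WeightedCW.Weight K a b) :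
    -- the barcodes exist in each degree, for either weight
    (∀ i : ℕ, ∃ α, WeightedCW.IsBarcodeOf α (w.persHomology k i)) ∧
    (∀ i : ℕ, ∃ β, WeightedCW.IsBarcodeOf β (v.persHomology k i)) ∧
    -- and, whatever barcodes `α i` and `β i` of the two persistence modules are taken,
    ∀ α β : ℕ → WeightedCW.Barcode (Set.Icc a (2 * b - a)),
      (∀ i, WeightedCW.IsBarcodeOf (α i) (w.persHomology k i)) →
      (∀ i, WeightedCW.IsBarcodeOf (β i) (v.persHomology k i)) →
      (∑' i, WeightedCW.W1Rank k (α i) (β i) ≤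
        ∑' σ : (Σ n, RelCWComplex.cell K n),
          WeightedCW.dRank (WeightedCW.freeModule k a b (w.val σ.1 σ.2))
            (WeightedCW.freeModule k a b (v.val σ.1 σ.2))) ∧
      ∀ i, WeightedCW.W1Rank k (α i) (β i) ≤
        (∑' σ : RelCWComplex.cell K i,
          WeightedCW.dRank (WeightedCW.freeModule k a b (w.val i σ))
            (WeightedCW.freeModule k a b (v.val i σ))) +
        ∑' σ : RelCWComplex.cell K (i + 1),
          WeightedCW.dRank (WeightedCW.freeModule k a b (w.val (i + 1) σ))
            (WeightedCW.freeModule k a b (v.val (i + 1) σ)) := by 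
  refine ⟨fun i => WeightedCW.exists_isBarcodeOf_persHomology w i,
    fun i => WeightedCW.exists_isBarcodeOf_persHomology v i, fun α β hα hβ => ?_⟩
  obtain ⟨C, hC, hdeg, htotal⟩ := WeightedCW.hasCellwiseCoupling (k := k) w v
  have hW : ∀ i, WeightedCW.W1Rank k (α i) (β i) ≤ C i := fun i =>
    WeightedCW.RankCoupling.W1Rank_le k (by rw [← (hα i).rankInv_eq, ← (hβ i).rankInv_eq]; exact hC i)
  simp only [WeightedCW.dRank_freeModule]
  constructor
  · refine (ENNReal.tsum_le_tsum hW).trans (htotal.trans (le_of_eq ?_))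
    rw [ENNReal.tsum_sigma']
    exact tsum_congr fun i => (tsum_fintype _).symm
  · intro i
    rw [tsum_fintype, tsum_fintype]
    exact (hW i).trans (hdeg i)
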